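/- Conventions. $B(x,r)$ denotes an open ball in a metric space. A continuum is a nonempty compact connected subset of a metric space; its length is its one-dimensional Hausdorff measure $\mathcal H^1$. The Hausdorff content is $\mathcal H^1_\infty(S)=\inf\{\sum_n \operatorname{diam}(U_n): S\subset\bigcup_n U_n\}$ (countable covers). Let $\mu$ be a Borel measure on a metric space $(X,d)$. It is doubling if there is a constant $C$ with $0<\mu(B(x,2r))\le C\mu(B(x,r))<\infty$ for all $x\in X$, $r>0$. The space is quasiconvex if there is a constant $C$ such that any $x,y\in X$ are joined by a curve of length at most $C\,d(x,y)$. It is $A_\infty$ on curves if there are constants $\tau<1$ and $\theta>0$ such that, whenever $x\in X$, $0<r\le\operatorname{diam}(X)$, and $S\subset B(x,r)$ is a Borel set with $\mu(S)>\tau\mu(B(x,r))$, there is a continuum $\gamma\subset B(x,r)$ with $\mathcal H^1(\gamma)\le r$ and $\mathcal H^1_\infty(\gamma\cap S)\ge\theta r$. For a compact metric space $Y$ and $r>0$, let $\mathcal F_r(Y)$ be the set of Borel measures $\nu$ on $Y$ that satisfy $\nu(B(y,s))\le s$ for all balls $B(y,s)\subset Y$ and are supported on some continuum $\gamma\subset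 Y$ with $\mathcal H^1(\gamma)\le r$; equip it with the weak* topology. For a Borel probability measure $\mathbb P$ on $\mathcal F_r(Y)$ put $$\nu_{\mathbb P}:=\frac1r\int \nu\,d\mathbb P(\nu).$$ A finite Borel measure $\sigma$ on $Y$ has a $1$-rectifiable representation of length $r$ in $L^p$ if there is such a $\mathbb P$ with $\sigma\ll\nu_{\mathbb P}$ and $d\sigma/d\nu_{\mathbb P}\in L^p(\nu_{\mathbb P})$; and $$\|\sigma\|_{L^p(r)}:=\inf_{\mathbb P}\Big\|\frac{d\sigma}{d\nu_{\mathbb P}}\Big\|_{L^p(\nu_{\mathbb P})},$$ the infimum being over all such $\mathbb P$ with $\sigma\ll\nu_{\mathbb P}$. Theorem. Let $(X,d,\mu)$ be a complete, doubling, and quasiconvex metric measure space which is $A_\infty$ on curves. Then there exist constants $1<p<\infty$ and $1\le A<\infty$ such that the following holds. For every $x\in X$ and every real $0<r\le\operatorname{diam}(X)$, the set $Y:=\overline{B(x,2r)}$ is compact, and the normalised restriction $$\mu_{x,r}:=\frac{\mu\llcorner_{B(x,r)}}{\mu(B(x,r))},$$ regarded as a measure on $Y$, has a $1$-rectifiable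 representation of length $r$ in $L^p$, with $\|\mu_{x,r}\|_{L^p(r)}\le A$. -/

import Mathlib

open MeasureTheory Set
open scoped ENNReal NNReal

noncomputable section

section Space

variable {X : Type*} [MetricSpace X]

/-- A continuum: a (nonempty) compact and connected subset of a metric space. -/
def IsContinuum (γ : Set X) : Prop := IsCompact γ ∧ IsConnected γ

/-- The space is quasiconvex: for some constant `C`, any two points `x, y` are joined by a curve
of length at most `C d(x,y)`. -/
def IsQuasiconvexSpace (X : Type*) [MetricSpace X] : Prop :=
  ∃ C : ℝ≥0, ∀ x y : X, ∃ γ : Path x y,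
    eVariationOn (fun t : unitInterval => γ t) Set.univ ≤ (C : ℝ≥0∞) * edist x y

/-- The one-dimensional Hausdorff content `H¹_∞(S)`: the infimum of the sums of diameters over all
countable covers of `S`. -/
def hausdorffContentOne (S : Set X) : ℝ≥0∞ :=
  ⨅ (t : ℕ → Set X) (_ : S ⊆ ⋃ n, t n), ∑' n, Metric.ediam (t n)

variable [MeasurableSpace X]

/-- Doubling measures: balls have positive and finite measure, and doubling the radius multiplies
the measure of a ball by at most a constant. -/
def IsDoublingMeasure (μ : Measure X) : Prop :=
  ∃ C : ℝ≥0, ∀ (x : X) (r : ℝ), 0 < r →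
    0 < μ (Metric.ball x r) ∧ μ (Metric.ball x r) < ∞ ∧
      μ (Metric.ball x (2 * r)) ≤ (C : ℝ≥0∞) * μ (Metric.ball x r)

/-- The metric measure space `(X, d, μ)` is `A_∞` on curves. The length of a continuum is its
one-dimensional Hausdorff measure. -/
def IsAInftyOnCurves [BorelSpace X] (μ : Measure X) : Prop :=
  ∃ (τ : ℝ≥0) (θ : ℝ), τ < 1 ∧ 0 < θ ∧
    ∀ (x : X) (r : ℝ), 0 < r → ENNReal.ofReal r ≤ Metric.ediam (Set.univ : Set X) →
      ∀ S : Set X, MeasurableSet S → S ⊆ Metric.ball x r →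
        (τ : ℝ≥0∞) * μ (Metric.ball x r) < μ S →
          ∃ γ : Set X, IsContinuum γ ∧ γ ⊆ Metric.ball x r ∧
            Measure.hausdorffMeasure 1 γ ≤ ENNReal.ofReal r ∧
            ENNReal.ofReal (θ * r) ≤ hausdorffContentOne (γ ∩ S)

/-- The normalised restriction `μ⌞B(x,r) / μ(B(x,r))`. -/
def normalizedRestriction (μ : Measure X) (x : X) (r : ℝ) : Measure X :=
  (μ (Metric.ball x r))⁻¹ • μ.restrict (Metric.ball x r)

end Space

section Representations

variable {Y : Type*} [MetricSpace Y] [MeasurableSpace Y] [BorelSpace Y]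

/-- A `1`-Frostman measure: `ν(B(y,s)) ≤ s` for all open balls. -/
def IsOneFrostman (ν : Measure Y) : Prop :=
  ∀ (y : Y) (s : ℝ), ν (Metric.ball y s) ≤ ENNReal.ofReal s

/-- The family `F_r(Y)` of `1`-Frostman measures supported on a continuum of length at most `r`.
(On a compact space Frostman measures are automatically finite.) -/
def FrostmanFamily (Y : Type*) [MetricSpace Y] [MeasurableSpace Y] [BorelSpace Y] (r : ℝ) :
    Type _ :=
  {ν : FiniteMeasure Y // IsOneFrostman (ν : Measure Y) ∧
    ∃ γ : Set Y, IsContinuum γ ∧ Measure.hausdorffMeasure 1 γ ≤ ENNReal.ofReal r ∧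
      (ν : Measure Y) γᶜ = 0}

/-- The measure underlying an element of `F_r(Y)`. -/
def FrostmanFamily.toMeasure {r : ℝ} (ν : FrostmanFamily Y r) : Measure Y :=
  (ν.val : Measure Y)

instance FrostmanFamily.isFiniteMeasure {r : ℝ} (ν : FrostmanFamily Y r) :
    IsFiniteMeasure ν.toMeasure :=
  inferInstanceAs (IsFiniteMeasure (ν.val : Measure Y))

/-- `F_r(Y)` carries the topology of weak convergence of measures, that is, on a compact space,
the weak* topology tested against continuous functions. -/
instance FrostmanFamily.topologicalSpace (r : ℝ) : TopologicalSpace (FrostmanFamily Y r) :=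
  inferInstanceAs (TopologicalSpace {ν : FiniteMeasure Y // IsOneFrostman (ν : Measure Y) ∧
    ∃ γ : Set Y, IsContinuum γ ∧ Measure.hausdorffMeasure 1 γ ≤ ENNReal.ofReal r ∧
      (ν : Measure Y) γᶜ = 0})

/-- `F_r(Y)` carries the Borel σ-algebra of the weak* topology. -/
instance FrostmanFamily.measurableSpace (r : ℝ) : MeasurableSpace (FrostmanFamily Y r) :=
  borel _

instance FrostmanFamily.borelSpace (r : ℝ) : BorelSpace (FrostmanFamily Y r) := ⟨rfl⟩

theorem FrostmanFamily.measurable_toMeasure (r : ℝ) :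
    Measurable (FrostmanFamily.toMeasure : FrostmanFamily Y r → Measure Y) := by
  have key : ∀ F : Set Y, IsClosed F →
      Measurable fun ν : FrostmanFamily Y r => ν.toMeasure F := by
    intro F hF
    let δ : ℕ → ℝ := fun n => 1 / ((n : ℝ) + 1)
    have hδ : ∀ n, 0 < δ n := fun n => Nat.one_div_pos_of_nat
    refine measurable_of_tendsto_metrizable
      (f := fun n (ν : FrostmanFamily Y r) =>
        ∫⁻ y, (thickenedIndicator (hδ n) F y : ℝ≥0∞) ∂ν.toMeasure) (fun n => ?_) ?_
    · have hc : Continuous fun ν : FrostmanFamily Y r =>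
          ((ν.val.testAgainstNN (thickenedIndicator (hδ n) F) : ℝ≥0) : ℝ≥0∞) :=
        ENNReal.continuous_coe.comp
          ((FiniteMeasure.continuous_testAgainstNN_eval _).comp continuous_subtype_val)
      have he : (fun ν : FrostmanFamily Y r =>
          ∫⁻ y, (thickenedIndicator (hδ n) F y : ℝ≥0∞) ∂ν.toMeasure) =
          fun ν : FrostmanFamily Y r =>
            ((ν.val.testAgainstNN (thickenedIndicator (hδ n) F) : ℝ≥0) : ℝ≥0∞) := by
        funext ν
        exact FiniteMeasure.testAgainstNN_coe_eq.symm
      rw [he]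
      exact hc.measurable
    · rw [tendsto_pi_nhds]
      intro ν
      exact tendsto_lintegral_thickenedIndicator_of_isClosed ν.toMeasure hF hδ
        tendsto_one_div_add_atTop_nhds_zero_nat
  exact Measurable.measure_of_isPiSystem
    (BorelSpace.measurable_eq.trans borel_eq_generateFrom_isClosed) isPiSystem_isClosed
    (fun F hF => key F hF) (key Set.univ isClosed_univ)

/-- The averaged measure `ν_P = (1/r) ∫ ν dP(ν)` of a Borel measure `P` on `F_r(Y)`. -/
def averagedMeasure {r : ℝ} (P : Measure (FrostmanFamily Y r)) : Measure Y :=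
  (ENNReal.ofReal r)⁻¹ • P.bind FrostmanFamily.toMeasure

theorem lintegral_averagedMeasure {r : ℝ} (P : Measure (FrostmanFamily Y r)) {φ : Y → ℝ≥0∞}
    (hφ : Measurable φ) :
    ∫⁻ y, φ y ∂(averagedMeasure P) =
      (ENNReal.ofReal r)⁻¹ * ∫⁻ ν, ∫⁻ y, φ y ∂ν.toMeasure ∂P := by
  rw [averagedMeasure, lintegral_smul_measure, Measure.lintegral_bind
    (FrostmanFamily.measurable_toMeasure r).aemeasurable hφ.aemeasurable, smul_eq_mul]

/-- `μ` has a `1`-rectifiable representation of length `r` in `L^p`: for some Borel probability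
measure `P` on `F_r(Y)`, `μ ≪ ν_P` with density in `L^p(ν_P)`. -/
def HasRectifiableRepresentation (μ : Measure Y) (r : ℝ) (p : ℝ≥0∞) : Prop :=
  ∃ P : Measure (FrostmanFamily Y r), IsProbabilityMeasure P ∧
    μ ≪ averagedMeasure P ∧ MemLp (μ.rnDeriv (averagedMeasure P)) p (averagedMeasure P)

/-- `‖μ‖_{L^p(r)}`: the infimum of the norms `‖dμ/dν_P‖_{L^p(ν_P)}` over all Borel probability
measures `P` on `F_r(Y)` with `μ ≪ ν_P`. -/
def representationNorm (μ : Measure Y) (r : ℝ) (p : ℝ≥0∞) : ℝ≥0∞ :=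
  ⨅ (P : Measure (FrostmanFamily Y r)) (_ : IsProbabilityMeasure P)
    (_ : μ ≪ averagedMeasure P),
    eLpNorm (μ.rnDeriv (averagedMeasure P)) p (averagedMeasure P)

end Representations

end

/-! Write σ for the normalised restriction. The `L^p` bound is dual to a test-function inequality:
if ∫ f dσ ≤ B + ½ ∫ f^q dν_P for all bounded measurable f ≥ 0, then σ ≪ ν_P, and testing with a
power of the truncated density bounds its p-th moment by 2B, where p = q/(q-1)
(`lintegral_rnDeriv_rpow_le`). The right side is affine in P and convex in f. A Hahn-Banach minimax
argument over a compact family of Frostman measures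
(`exists_probabilityMeasure_forall_integral_nonneg`) therefore reduces the search for one P serving
all f to the search, for each single continuous φ ≥ 0, of one Frostman measure ν with ∫ φ dσ ≤ B +
(1/2r) ∫ φ^q dν. Superlevel sets of φ supply it (`exists_mem_integral_le`), once every open S ⊆
B(x,r) of relative measure at least ε is known to carry Frostman mass at least c ε^n r on a
continuum of length at most r/4.

This polynomial bound (`IsAInftyOnCurves.exists_carriesFrostmanMeasure`) is a self-improvement of
the A_∞ condition, which only speaks of density above τ. Replace S by the union of the doubles of
all small balls in which S has density above τ. By doubling, the measure grows by a definite factor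
Λ > 1 unless one of these balls has radius comparable to the maximal scale ρ
(`le_measure_densityEnlargement`). About log(1/ε) such steps exhaust the room available, so at some
stage a ball of radius comparable to ρ is dense and carries mass directly. Each step is undone by
`CarriesFrostmanMeasure.pullback`: a Frostman measure on the enlarged set is redistributed to
measures inside dense balls of the old set, whose continua are tied to the old continuum by
quasiconvexity. Length and mass change by constant factors per step, hence the total loss is a power
of ε.

Compactness of the family requires a length bound that survives Hausdorff limits of continua. A
bound on separated subsets does; for continua it is comparable to length up to a factor 4, which is
why curves of length r/4 are produced. -/

noncomputable section

open Filter Topology Metric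

/-! ### Length of connected sets and of paths -/

section Lengths

variable {X : Type*} [MetricSpace X] [MeasurableSpace X] [BorelSpace X]

/-- A connected set that meets the centre of a ball and leaves the ball has length at least the
radius inside the ball. -/
theorem IsPreconnected.ofReal_le_hausdorffMeasure_inter_ball {γ : Set X} (hγ : IsPreconnected γ)
    {z : X} (hz : z ∈ γ) {s : ℝ} (hout : ¬ γ ⊆ ball z s) :
    ENNReal.ofReal s ≤ μH[1] (γ ∩ ball z s) := by
  obtain ⟨w, hw, hws⟩ := not_subset.1 hout
  have hlip : LipschitzWith 1 (fun y : X => dist y z) := LipschitzWith.dist_left z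
  -- On γ the distance to `z` takes every value between 0 and `dist w z ≥ s`; values below `s` are
  -- attained inside the ball.
  have himg : Ico 0 s ⊆ (fun y : X => dist y z) '' (γ ∩ ball z s) := by
    intro t ht
    have hconn : IsPreconnected ((fun y : X => dist y z) '' γ) :=
      hγ.image _ hlip.continuous.continuousOn
    have hsub := hconn.Icc_subset (a := 0) (b := dist w z) ⟨z, hz, dist_self z⟩ ⟨w, hw, rfl⟩
    have hsw : s ≤ dist w z := by simpa using hws
    obtain ⟨y, hy, hyt⟩ := hsub ⟨ht.1, ht.2.le.trans hsw⟩
    refine ⟨y, ⟨hy, ?_⟩, hyt⟩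
    rw [mem_ball]
    exact lt_of_eq_of_lt hyt ht.2
  calc ENNReal.ofReal s = volume (Ico (0 : ℝ) s) := by simp
    _ = μH[1] (Ico (0 : ℝ) s) := by rw [hausdorffMeasure_real]
    _ ≤ μH[1] ((fun y : X => dist y z) '' (γ ∩ ball z s)) := measure_mono himg
    _ ≤ (1 : ℝ≥0) ^ (1 : ℝ) * μH[1] (γ ∩ ball z s) :=
      (hlip.lipschitzOnWith).hausdorffMeasure_image_le zero_le_one
    _ = μH[1] (γ ∩ ball z s) := by simp

/-- Finite covers by small sets with controlled total diameter bound the length. -/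
theorem hausdorffMeasure_one_le_of_finite_covers {s : Set X} {V : ℝ≥0∞}
    (h : ∀ ε : ℝ, 0 < ε → ∃ (N : ℕ) (t : Fin N → Set X), s ⊆ ⋃ i, t i ∧
      (∀ i, ediam (t i) ≤ ENNReal.ofReal ε) ∧ ∑ i, ediam (t i) ≤ V + ENNReal.ofReal ε) :
    μH[1] s ≤ V := by
  have hε : ∀ n : ℕ, (0 : ℝ) < 1 / ((n : ℝ) + 1) := fun n => Nat.one_div_pos_of_nat
  choose N t hcov hdiam hsum using fun n : ℕ => h _ (hε n)
  have hlim : Tendsto (fun n : ℕ => ENNReal.ofReal (1 / ((n : ℝ) + 1))) atTop (𝓝 0) := by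
    simpa using ENNReal.tendsto_ofReal tendsto_one_div_add_atTop_nhds_zero_nat
  have hbound := Measure.hausdorffMeasure_le_liminf_sum 1 s _ hlim t
    (Eventually.of_forall hdiam) (Eventually.of_forall hcov)
  refine hbound.trans ?_
  have hV : Tendsto (fun n : ℕ => V + ENNReal.ofReal (1 / ((n : ℝ) + 1))) atTop (𝓝 V) := by
    simpa using tendsto_const_nhds.add hlim
  rw [← hV.liminf_eq]
  refine liminf_le_liminf (Eventually.of_forall fun n => ?_)
  simpa using hsum n

/-- The length of the image of a path is at most its variation. -/
theorem Path.hausdorffMeasure_range_le {x y : X} (γ : Path x y) :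
    μH[1] (range γ) ≤ eVariationOn (fun t : unitInterval => γ t) univ := by
  refine hausdorffMeasure_one_le_of_finite_covers fun ε hε => ?_
  obtain ⟨t, ht0, htm, ⟨N, hN⟩, hcov⟩ := exists_monotone_Icc_subset_open_cover_unitInterval
    (c := fun p : X => γ ⁻¹' ball p (ε / 2)) (fun p => isOpen_ball.preimage γ.continuous)
    (fun s _ => mem_iUnion.2 ⟨γ s, mem_ball_self (half_pos hε)⟩)
  refine ⟨N, fun i => γ '' Icc (t i) (t (i + 1)), ?_, fun i => ?_, ?_⟩
  · rintro _ ⟨s, rfl⟩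
    have hs : s ∈ Icc (t 0) (t N) := ⟨ht0 ▸ s.2.1, (hN N le_rfl).symm ▸ s.2.2⟩
    rw [mem_iUnion]
    rcases eq_or_ne N 0 with rfl | hN0
    · exact absurd (ht0.symm.trans (hN 0 le_rfl)) zero_ne_one
    -- The half-open pieces used below miss the initial point.
    by_cases hst : s = t 0
    · exact ⟨⟨0, Nat.pos_of_ne_zero hN0⟩, s, ⟨hst.ge, hst.le.trans (htm (Nat.le_succ 0))⟩, rfl⟩
    have hs' : s ∈ Ioc (t 0) (t N) := ⟨lt_of_le_of_ne hs.1 (Ne.symm hst), hs.2⟩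
    have := hs'
    rw [← htm.biUnion_Ico_Ioc_map_succ 0 N, mem_iUnion₂] at this
    obtain ⟨i, hi, hsi⟩ := this
    exact ⟨⟨i, hi.2⟩, s, ⟨hsi.1.le, hsi.2⟩, rfl⟩
  · obtain ⟨p, hp⟩ := hcov i
    calc ediam (γ '' Icc (t i) (t (i + 1))) ≤ ediam (ball p (ε / 2)) :=
          ediam_mono (image_subset_iff.2 hp)
      _ ≤ 2 * ENNReal.ofReal (ε / 2) := by
          rw [← Metric.eball_ofReal]; exact ediam_eball_le
      _ = ENNReal.ofReal ε := by
          rw [← ENNReal.ofReal_ofNat, ← ENNReal.ofReal_mul (by norm_num)]; congr 1; ring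
  · refine le_add_right ?_
    have hpiece : ∀ i : ℕ, ediam (γ '' Icc (t i) (t (i + 1))) ≤
        eVariationOn (fun t : unitInterval => γ t) (univ ∩ Icc (t i) (t (i + 1))) := by
      intro i
      refine ediam_le ?_
      rintro _ ⟨a, ha, rfl⟩ _ ⟨b, hb, rfl⟩
      exact eVariationOn.edist_le (fun t : unitInterval => γ t) ⟨mem_univ _, ha⟩ ⟨mem_univ _, hb⟩
    calc ∑ i : Fin N, ediam (γ '' Icc (t i) (t (i + 1)))
        = ∑ i ∈ Finset.range N, ediam (γ '' Icc (t i) (t (i + 1))) :=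
          Fin.sum_univ_eq_sum_range (fun i => ediam (γ '' Icc (t i) (t (i + 1)))) N
      _ ≤ ∑ i ∈ Finset.range N,
          eVariationOn (fun t : unitInterval => γ t) (univ ∩ Icc (t i) (t (i + 1))) :=
          Finset.sum_le_sum fun i _ => hpiece i
      _ = eVariationOn (fun t : unitInterval => γ t) (univ ∩ Icc (t 0) (t N)) :=
          eVariationOn.sum _ htm fun _ _ _ => mem_univ _
      _ ≤ _ := eVariationOn.mono _ (subset_univ _)

end Lengths

/-! ### Complete doubling spaces are proper -/

section Doubling

variable {X : Type*} [MetricSpace X] [MeasurableSpace X]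

theorem IsDoublingMeasure.measure_ball_pow_le {μ : Measure X} {C : ℝ≥0}
    (hC : ∀ (x : X) (r : ℝ), 0 < r → 0 < μ (ball x r) ∧ μ (ball x r) < ∞ ∧
      μ (ball x (2 * r)) ≤ C * μ (ball x r)) (x : X) {r : ℝ} (hr : 0 < r) (n : ℕ) :
    μ (ball x (2 ^ n * r)) ≤ (C : ℝ≥0∞) ^ n * μ (ball x r) := by
  induction n with
  | zero => simp
  | succ n ih =>
    calc μ (ball x (2 ^ (n + 1) * r)) = μ (ball x (2 * (2 ^ n * r))) := by ring_nf
      _ ≤ C * μ (ball x (2 ^ n * r)) := (hC x _ (by positivity)).2.2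
      _ ≤ C * ((C : ℝ≥0∞) ^ n * μ (ball x r)) := by gcongr
      _ = _ := by ring

theorem IsDoublingMeasure.properSpace [BorelSpace X] [CompleteSpace X] {μ : Measure X}
    (hμ : IsDoublingMeasure μ) : ProperSpace X := by
  obtain ⟨C, hC⟩ := hμ
  refine ⟨fun x R => ?_⟩
  refine TotallyBounded.isCompact_of_isClosed ?_ isClosed_closedBall
  rw [Metric.totallyBounded_iff]
  intro ε hε
  have hε' : 0 < ε / 6 := by positivity
  obtain ⟨u, hu, hdisj, hcov⟩ := Vitali.exists_disjoint_subfamily_covering_enlargement_closedBall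
    (closedBall x R) (fun a => a) (fun _ => ε / 6) (ε / 6) (fun _ _ => le_rfl) 5 (by norm_num)
  have hcover : closedBall x R ⊆ ⋃ y ∈ u, ball y ε := by
    intro a ha
    obtain ⟨b, hb, hab⟩ := hcov a ha
    refine mem_iUnion₂.2 ⟨b, hb, ?_⟩
    have := hab (mem_closedBall_self hε'.le)
    rw [mem_closedBall] at this
    rw [mem_ball]
    linarith
  refine ⟨u, ?_, hcover⟩
  rcases u.eq_empty_or_nonempty with rfl | ⟨b₀, hb₀⟩
  · exact finite_empty
  have hR : 0 ≤ R := dist_nonneg.trans (hu hb₀)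
  -- With this `n`, the ball of radius `2 ^ n * (ε / 6)` about any centre in `u` contains `ball x (R
  -- + ε)`. The disjoint small balls thus have a common lower mass bound inside a ball of finite
  -- mass, so there are finitely many.
  obtain ⟨n, hn⟩ := pow_unbounded_of_one_lt ((2 * R + ε) / (ε / 6)) (one_lt_two (α := ℝ))
  rw [div_lt_iff₀ hε'] at hn
  have hlow : ∀ b ∈ u, μ (ball x (R + ε)) / (C : ℝ≥0∞) ^ n ≤ μ (ball b (ε / 6)) := by
    intro b hb
    refine ENNReal.div_le_of_le_mul' (le_trans (measure_mono ?_)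
      (IsDoublingMeasure.measure_ball_pow_le hC b hε' n))
    have := mem_closedBall.1 (hu hb)
    refine ball_subset_ball' ?_
    rw [dist_comm]; linarith
  have hpos : 0 < μ (ball x (R + ε)) / (C : ℝ≥0∞) ^ n :=
    ENNReal.div_pos (hC x _ (by positivity)).1.ne' (by simp)
  have hfin := Measure.finite_const_le_meas_of_disjoint_iUnion₀ (μ := μ) (ι := u) hpos
    (As := fun b => ball (b : X) (ε / 6)) (fun b => isOpen_ball.measurableSet.nullMeasurableSet)
    (fun a b hab => (Disjoint.mono ball_subset_closedBall ball_subset_closedBall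
      (hdisj a.2 b.2 fun h => hab (Subtype.ext h))).aedisjoint) (by
      refine ((measure_mono ?_).trans_lt (hC x (R + ε) (by positivity)).2.1).ne
      refine iUnion_subset fun b => ball_subset_ball' ?_
      have := mem_closedBall.1 (hu b.2)
      linarith)
  have : (univ : Set u).Finite := hfin.subset fun b _ => hlow b b.2
  exact Set.finite_coe_iff.1 (Set.finite_univ_iff.1 this)

end Doubling

/-! ### From Hausdorff content to Frostman measures -/

section Content

variable {X : Type*} [MetricSpace X]

/-- The one-dimensional Hausdorff content as an outer measure. -/
def hausdorffContentOuterMeasure (X : Type*) [MetricSpace X] : OuterMeasure X :=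
  OuterMeasure.ofFunction ediam ediam_empty

theorem hausdorffContentOne_eq (S : Set X) :
    hausdorffContentOne S = hausdorffContentOuterMeasure X S :=
  (OuterMeasure.ofFunction_apply _ _ _).symm

theorem hausdorffContentOuterMeasure_le_ediam (S : Set X) :
    hausdorffContentOuterMeasure X S ≤ ediam S :=
  OuterMeasure.ofFunction_le S

theorem hausdorffContentOuterMeasure_le_hausdorffMeasure [MeasurableSpace X] [BorelSpace X]
    (S : Set X) : hausdorffContentOuterMeasure X S ≤ μH[1] S := by
  rw [Measure.hausdorffMeasure_apply, ← hausdorffContentOne_eq, hausdorffContentOne]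
  -- Content is the premeasure at mesh size `⊤`, one term of the supremum defining `μH[1]`.
  refine le_trans ?_ (le_iSup₂ (⊤ : ℝ≥0∞) ENNReal.zero_lt_top)
  refine iInf_mono fun t => iInf_mono fun _ => ?_
  refine le_iInf fun _ => ENNReal.tsum_le_tsum fun n => ?_
  rcases (t n).eq_empty_or_nonempty with h | h
  · simp [h]
  · simp [h]

/-- Restricted length fails to be Frostman only in balls where γ has too much length, more than `M`
times the radius. By Vitali the union `Z` of these balls has content at most (10/M) s, and M = 20/θ
makes this half of the given content. What remains of γ ∩ S outside `Z` has length at least θs/2;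
dividing length there by `M` gives a Frostman measure of mass at least θ²s/40. -/
theorem exists_isOneFrostman_of_content [MeasurableSpace X] [BorelSpace X]
    [SecondCountableTopology X] {γ S : Set X} {s θ : ℝ} (hs : 0 < s) (hθ : 0 < θ)
    (hγ : MeasurableSet γ) (hγs : μH[1] γ ≤ ENNReal.ofReal s) (hS : MeasurableSet S)
    (hcont : ENNReal.ofReal (θ * s) ≤ hausdorffContentOne (γ ∩ S)) :
    ∃ ν : Measure X, IsOneFrostman ν ∧ ν (γ ∩ S)ᶜ = 0 ∧
      ENNReal.ofReal (θ ^ 2 / 40 * s) ≤ ν (γ ∩ S) := by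
  set M : ℝ := 20 / θ with hM
  have hMpos : 0 < M := by positivity
  set T : Set (X × ℝ) := {b | 0 < b.2 ∧ ENNReal.ofReal (M * b.2) < μH[1] (γ ∩ ball b.1 b.2)}
    with hT
  set Z : Set X := ⋃ b ∈ T, ball b.1 b.2 with hZ
  have hZo : IsOpen Z := isOpen_biUnion fun _ _ => isOpen_ball
  have hrad : ∀ b ∈ T, b.2 ≤ s / M := by
    intro b hb
    rw [le_div_iff₀ hMpos, mul_comm]
    exact ((ENNReal.ofReal_lt_ofReal_iff hs).1
      (hb.2.trans_le ((measure_mono inter_subset_left).trans hγs))).le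
  obtain ⟨u, huT, hdisj, hcov⟩ := Vitali.exists_disjoint_subfamily_covering_enlargement_closedBall
    T Prod.fst Prod.snd (s / M) hrad 5 (by norm_num)
  have hdisj' : u.PairwiseDisjoint fun b => ball b.1 b.2 :=
    hdisj.mono fun _ => ball_subset_closedBall
  have hcount : u.Countable := hdisj'.countable_of_isOpen (fun _ _ => isOpen_ball)
    fun b hb => nonempty_ball.2 (huT hb).1
  have hsum : ∑' b : u, ENNReal.ofReal (M * b.1.2) ≤ ENNReal.ofReal s := by
    calc ∑' b : u, ENNReal.ofReal (M * b.1.2)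
        ≤ ∑' b : u, μH[1].restrict γ (ball b.1.1 b.1.2) := by
          refine ENNReal.tsum_le_tsum fun b => ?_
          rw [Measure.restrict_apply isOpen_ball.measurableSet, inter_comm]
          exact (huT b.2).2.le
      _ = μH[1].restrict γ (⋃ b ∈ u, ball b.1 b.2) :=
          (measure_biUnion hcount hdisj' fun _ _ => isOpen_ball.measurableSet).symm
      _ ≤ μH[1].restrict γ univ := measure_mono (subset_univ _)
      _ ≤ ENNReal.ofReal s := by simpa using hγs
  have hcontZ : hausdorffContentOuterMeasure X Z ≤ ENNReal.ofReal (θ * s / 2) := by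
    have hsub : Z ⊆ ⋃ b ∈ u, closedBall b.1 (5 * b.2) := by
      refine iUnion₂_subset fun a ha => ?_
      obtain ⟨b, hb, hab⟩ := hcov a ha
      exact (ball_subset_closedBall.trans hab).trans
        (subset_biUnion_of_mem (u := fun b : X × ℝ => closedBall b.1 (5 * b.2)) hb)
    calc hausdorffContentOuterMeasure X Z
        ≤ hausdorffContentOuterMeasure X (⋃ b ∈ u, closedBall b.1 (5 * b.2)) := measure_mono hsub
      _ ≤ ∑' b : u, hausdorffContentOuterMeasure X (closedBall b.1.1 (5 * b.1.2)) :=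
          measure_biUnion_le _ hcount _
      _ ≤ ∑' b : u, ENNReal.ofReal (10 / M) * ENNReal.ofReal (M * b.1.2) := by
          refine ENNReal.tsum_le_tsum fun b => ?_
          have hb := (huT b.2).1
          refine (hausdorffContentOuterMeasure_le_ediam _).trans ?_
          rw [← Metric.closedEBall_ofReal (by positivity)]
          refine ediam_closedEBall_le.trans (le_of_eq ?_)
          rw [← ENNReal.ofReal_ofNat, ← ENNReal.ofReal_mul (by norm_num),
            ← ENNReal.ofReal_mul (by positivity)]
          congr 1
          field_simp
          norm_num
      _ = ENNReal.ofReal (10 / M) * ∑' b : u, ENNReal.ofReal (M * b.1.2) := ENNReal.tsum_mul_left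
      _ ≤ ENNReal.ofReal (10 / M) * ENNReal.ofReal s := by gcongr
      _ = ENNReal.ofReal (θ * s / 2) := by
          rw [← ENNReal.ofReal_mul (by positivity)]
          congr 1
          rw [hM]; field_simp; norm_num
  have hmass : ENNReal.ofReal (θ * s / 2) ≤ μH[1] ((γ ∩ S) \ Z) := by
    have h1 : ENNReal.ofReal (θ * s) ≤ ENNReal.ofReal (θ * s / 2) + μH[1] ((γ ∩ S) \ Z) := by
      rw [hausdorffContentOne_eq] at hcont
      calc ENNReal.ofReal (θ * s) ≤ hausdorffContentOuterMeasure X (γ ∩ S) := hcont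
        _ ≤ hausdorffContentOuterMeasure X (Z ∪ ((γ ∩ S) \ Z)) :=
            measure_mono (by rw [union_sdiff_self]; exact subset_union_right)
        _ ≤ hausdorffContentOuterMeasure X Z + hausdorffContentOuterMeasure X ((γ ∩ S) \ Z) :=
            measure_union_le _ _
        _ ≤ _ := add_le_add hcontZ (hausdorffContentOuterMeasure_le_hausdorffMeasure _)
    have h2 : ENNReal.ofReal (θ * s) =
        ENNReal.ofReal (θ * s / 2) + ENNReal.ofReal (θ * s / 2) := by
      rw [← ENNReal.ofReal_add (by positivity) (by positivity)]; congr 1; ring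
    rw [h2] at h1
    exact (ENNReal.add_le_add_iff_left ENNReal.ofReal_ne_top).1 h1
  refine ⟨ENNReal.ofReal M⁻¹ • μH[1].restrict ((γ ∩ S) \ Z), fun y t => ?_, ?_, ?_⟩
  · rw [Measure.smul_apply, smul_eq_mul, Measure.restrict_apply isOpen_ball.measurableSet]
    rcases le_or_gt t 0 with ht | ht
    · simp [ball_eq_empty.2 ht]
    -- A bad ball lies in `Z` and has no mass; a good one satisfies the bound by definition.
    by_cases hb : (y, t) ∈ T
    · have : ball y t ∩ ((γ ∩ S) \ Z) = ∅ := by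
        refine eq_empty_of_forall_notMem fun w hw => hw.2.2 ?_
        exact mem_biUnion (x := (y, t)) hb hw.1
      simp [this]
    · have hle : μH[1] (γ ∩ ball y t) ≤ ENNReal.ofReal (M * t) := by
        by_contra hlt
        exact hb ⟨ht, not_le.1 hlt⟩
      calc ENNReal.ofReal M⁻¹ * μH[1] (ball y t ∩ ((γ ∩ S) \ Z))
          ≤ ENNReal.ofReal M⁻¹ * ENNReal.ofReal (M * t) := by
            gcongr
            refine (measure_mono ?_).trans hle
            exact fun w hw => ⟨hw.2.1.1, hw.1⟩
        _ = ENNReal.ofReal t := by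
            rw [← ENNReal.ofReal_mul (by positivity)]
            congr 1; field_simp
  · rw [Measure.smul_apply, Measure.restrict_apply (hγ.inter hS).compl]
    have : (γ ∩ S)ᶜ ∩ ((γ ∩ S) \ Z) = ∅ := by
      ext w; simp only [mem_inter_iff, mem_compl_iff, Set.mem_sdiff, mem_empty_iff_false]; tauto
    simp [this]
  · rw [Measure.smul_apply, smul_eq_mul, Measure.restrict_apply (hγ.inter hS),
      inter_eq_right.2 sdiff_subset]
    calc ENNReal.ofReal (θ ^ 2 / 40 * s) = ENNReal.ofReal M⁻¹ * ENNReal.ofReal (θ * s / 2) := by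
          rw [← ENNReal.ofReal_mul (by positivity)]
          congr 1
          rw [hM]; field_simp; norm_num
      _ ≤ _ := by gcongr

end Content

/-! ### Gluing continua and redistributing measures -/

section Gluing

theorem exists_measurable_disjoint_refinement {ι α : Type*} [MeasurableSpace α]
    (u : Finset ι) (B : ι → Set α) (hB : ∀ b, MeasurableSet (B b)) :
    ∃ A : ι → Set α, (∀ b, MeasurableSet (A b)) ∧ (∀ b, A b ⊆ B b) ∧
      (u : Set ι).PairwiseDisjoint A ∧ ⋃ b ∈ u, A b = ⋃ b ∈ u, B b := by
  classical
  induction u using Finset.induction_on with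
  | empty => exact ⟨B, hB, fun _ => Subset.rfl, by simp, rfl⟩
  | insert a u ha ih =>
    obtain ⟨A, hA, hAB, hdisj, hun⟩ := ih
    have hne : ∀ b ∈ u, b ≠ a := fun b hb h => ha (h ▸ hb)
    have hun' : ⋃ b ∈ u, Function.update A a (B a \ ⋃ b ∈ u, B b) b = ⋃ b ∈ u, B b := by
      rw [← hun]
      exact iUnion₂_congr fun b hb => by rw [Function.update_of_ne (hne b hb)]
    refine ⟨Function.update A a (B a \ ⋃ b ∈ u, B b), fun b => ?_, fun b => ?_, ?_, ?_⟩
    · rcases eq_or_ne b a with rfl | hb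
      · simpa using (hB b).diff (u.measurableSet_biUnion fun b _ => hB b)
      · simpa [hb] using hA b
    · rcases eq_or_ne b a with rfl | hb
      · simp
      · simpa [hb] using hAB b
    · rw [Finset.coe_insert, pairwiseDisjoint_insert_of_notMem (by simpa using ha)]
      refine ⟨fun b hb c hc hbc => ?_, fun b hb => ?_⟩
      · simp only [Function.onFun, Function.update_of_ne (hne b hb),
          Function.update_of_ne (hne c hc)]
        exact hdisj hb hc hbc
      · rw [Function.update_self, Function.update_of_ne (hne b hb)]
        refine disjoint_sdiff_left.mono_right ((hAB b).trans ?_)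
        exact subset_biUnion_of_mem (u := B) (show b ∈ u from hb)
    · rw [Finset.set_biUnion_insert, Finset.set_biUnion_insert, hun', Function.update_self,
        sdiff_union_self]

variable {X : Type*} [MetricSpace X]

theorem IsContinuum.union_biUnion {ι : Type*} {γ : Set X} (hγ : IsContinuum γ) (u : Finset ι)
    {E : ι → Set X} (hE : ∀ b ∈ u, IsContinuum (E b)) (hmeet : ∀ b ∈ u, (γ ∩ E b).Nonempty) :
    IsContinuum (γ ∪ ⋃ b ∈ u, E b) := by
  obtain ⟨x, hx⟩ := hγ.2.nonempty
  refine ⟨hγ.1.union (u.isCompact_biUnion fun b hb => (hE b hb).1), ⟨x, Or.inl hx⟩, ?_⟩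
  refine isPreconnected_of_forall x fun y hy => ?_
  rcases hy with hy | hy
  · exact ⟨γ, subset_union_left, hx, hy, hγ.2.isPreconnected⟩
  · obtain ⟨b, hb, hyb⟩ := mem_iUnion₂.1 hy
    obtain ⟨w, hw⟩ := hmeet b hb
    exact ⟨γ ∪ E b, union_subset_union_right _ (subset_biUnion_of_mem (u := E) hb), Or.inl hx,
      Or.inr hyb, hγ.2.isPreconnected.union w hw.1 hw.2 (hE b hb).2.isPreconnected⟩

variable [MeasurableSpace X]

/-- Redistributing a Frostman measure, ball by ball, along Frostman measures that live in a
separated family of balls. -/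
theorem IsOneFrostman.redistribute [OpensMeasurableSpace X] {ν : Measure X} (hν : IsOneFrostman ν)
    {u : Finset X}
    {s : X → ℝ} {y : X → X} {A : X → Set X} {κ : X → Measure X} (hs : ∀ b ∈ u, 0 < s b)
    (hdisj : (u : Set X).PairwiseDisjoint fun b => closedBall b (4 * s b))
    (hy : ∀ b ∈ u, dist b (y b) < 2 * s b) (hA : ∀ b, MeasurableSet (A b))
    (hAs : ∀ b ∈ u, A b ⊆ closedBall b (20 * s b)) (hAd : (u : Set X).PairwiseDisjoint A)
    (hκ : ∀ b ∈ u, IsOneFrostman (κ b)) (hκs : ∀ b ∈ u, κ b (ball (y b) (s b))ᶜ = 0) :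
    IsOneFrostman ((3 : ℝ≥0∞)⁻¹ • ∑ b ∈ u, (ν (A b) / ENNReal.ofReal (21 * s b)) • κ b) := by
  classical
  intro x t
  rcases le_or_gt t 0 with ht | ht
  · simp [ball_eq_empty.2 ht]
  have hnear : ∀ b ∈ u, κ b (ball x t) ≠ 0 → dist x (y b) < t + s b := by
    intro b hb hne
    by_contra! hle
    refine hne (measure_mono_null (fun w hw => ?_) (hκs b hb))
    simp only [mem_compl_iff, mem_ball, not_lt] at hw ⊢
    have := dist_triangle_left x (y b) w
    linarith
  have hweight : ∀ b ∈ u, ν (A b) / ENNReal.ofReal (21 * s b) ≤ 1 := by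
    intro b hb
    refine ENNReal.div_le_of_le_mul ?_
    rw [one_mul]
    have := hs b hb
    refine (measure_mono ((hAs b hb).trans ?_)).trans (hν b (21 * s b))
    exact closedBall_subset_ball (by linarith)
  have htot : ∀ b ∈ u, κ b (ball x t) ≤ ENNReal.ofReal (s b) := by
    intro b hb
    calc κ b (ball x t) ≤ κ b (ball (y b) (s b) ∪ (ball (y b) (s b))ᶜ) := by
          rw [union_compl_self]; exact measure_mono (subset_univ _)
      _ ≤ κ b (ball (y b) (s b)) + κ b (ball (y b) (s b))ᶜ := measure_union_le _ _
      _ ≤ ENNReal.ofReal (s b) := by rw [hκs b hb, add_zero]; exact hκ b hb _ _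
  set v := u.filter fun b => κ b (ball x t) ≠ 0 with hv
  set f : X → ℝ≥0∞ := fun b => ν (A b) / ENNReal.ofReal (21 * s b) * κ b (ball x t) with hf
  have hvu : ∀ b ∈ v, b ∈ u ∧ κ b (ball x t) ≠ 0 := fun b hb => Finset.mem_filter.1 hb
  have hsumv : ∑ b ∈ u, f b = ∑ b ∈ v, f b := by
    refine (Finset.sum_subset (Finset.filter_subset _ _) fun b hb hbv => ?_).symm
    have : κ b (ball x t) = 0 := by
      by_contra h
      exact hbv (Finset.mem_filter.2 ⟨hb, h⟩)
    simp [hf, this]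
  -- If `t < s b` and κ b charges `ball x t`, then dist(x,b) < t + s b + 2 s b < 4 s b. The balls of
  -- radius 4 s are disjoint, so at most one such `b` exists; its weight is at most 1 and κ b is
  -- Frostman.
  have hlarge : ∑ b ∈ v.filter (fun b => t < s b), f b ≤ ENNReal.ofReal t := by
    have hcard : (v.filter fun b => t < s b).card ≤ 1 := by
      rw [Finset.card_le_one]
      intro a ha b hb
      by_contra hab
      have key : ∀ b ∈ v.filter (fun b => t < s b), x ∈ closedBall b (4 * s b) := by
        intro b hb
        obtain ⟨hbv, hbt⟩ := Finset.mem_filter.1 hb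
        have h1 := hnear b (hvu b hbv).1 (hvu b hbv).2
        have h2 := hy b (hvu b hbv).1
        have h3 := dist_triangle_right x b (y b)
        rw [mem_closedBall]; linarith
      exact disjoint_left.1 (hdisj (hvu a (Finset.mem_filter.1 ha).1).1
        (hvu b (Finset.mem_filter.1 hb).1).1 hab) (key a ha) (key b hb)
    refine (Finset.sum_le_card_nsmul _ _ (ENNReal.ofReal t) fun b hb => ?_).trans ?_
    · have hbu := (hvu b (Finset.mem_filter.1 hb).1).1
      calc f b ≤ 1 * κ b (ball x t) := mul_le_mul_left (hweight b hbu) _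
        _ ≤ ENNReal.ofReal t := by rw [one_mul]; exact hκ b hbu _ _
    · calc _ ≤ 1 • ENNReal.ofReal t := nsmul_le_nsmul_left (by positivity) hcard
        _ = _ := one_nsmul _
  -- For `s b ≤ t` only the total mass counts: each term is at most ν(A b)/21, and the disjoint sets
  -- `A b` lie within t + s + 2s + 20s ≤ 24t of `x`. Together with the previous case this gives 3t,
  -- whence the factor 1/3.
  have hsmall : ∑ b ∈ v.filter (fun b => ¬ t < s b), f b ≤ ENNReal.ofReal (2 * t) := by
    set w := v.filter (fun b => ¬ t < s b) with hw
    have hwu : ∀ b ∈ w, b ∈ u := fun b hb => (hvu b (Finset.mem_filter.1 hb).1).1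
    calc ∑ b ∈ w, f b ≤ ∑ b ∈ w, ν (A b) * (ENNReal.ofReal 21)⁻¹ := by
          refine Finset.sum_le_sum fun b hb => ?_
          have hsb := hs b (hwu b hb)
          have hne : ENNReal.ofReal (s b) ≠ 0 := by simpa using hsb
          calc f b ≤ ν (A b) / ENNReal.ofReal (21 * s b) * ENNReal.ofReal (s b) :=
                mul_le_mul_right (htot b (hwu b hb)) _
            _ = ν (A b) * (ENNReal.ofReal 21)⁻¹ := by
                rw [ENNReal.ofReal_mul (by norm_num), div_eq_mul_inv,
                  ENNReal.mul_inv (Or.inr ENNReal.ofReal_ne_top) (Or.inr hne), mul_assoc,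
                  mul_assoc, ENNReal.inv_mul_cancel hne ENNReal.ofReal_ne_top, mul_one]
      _ = ν (⋃ b ∈ w, A b) * (ENNReal.ofReal 21)⁻¹ := by
          rw [← Finset.sum_mul, measure_biUnion_finset
            (hAd.subset fun b hb => hwu b hb) fun b _ => hA b]
      _ ≤ ENNReal.ofReal (24 * t) * (ENNReal.ofReal 21)⁻¹ := by
          refine mul_le_mul_left ((measure_mono ?_).trans (hν x (24 * t))) _
          refine iUnion₂_subset fun b hb z hz => ?_
          have hbt := not_lt.1 (Finset.mem_filter.1 hb).2
          have h1 := hnear b (hwu b hb) (hvu b (Finset.mem_filter.1 hb).1).2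
          have h2 := hy b (hwu b hb)
          have h3 := dist_triangle_right x b (y b)
          have h4 := mem_closedBall.1 (hAs b (hwu b hb) hz)
          have h5 := dist_triangle_right z x b
          rw [mem_ball]; linarith
      _ ≤ ENNReal.ofReal (2 * t) := by
          rw [← ENNReal.ofReal_inv_of_pos (by norm_num), ← ENNReal.ofReal_mul (by positivity)]
          exact ENNReal.ofReal_le_ofReal (by linarith)
  have hall : ∑ b ∈ u, f b ≤ 3 * ENNReal.ofReal t := by
    rw [hsumv, ← Finset.sum_filter_add_sum_filter_not v (fun b => t < s b)]
    refine (add_le_add hlarge hsmall).trans (le_of_eq ?_)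
    rw [← ENNReal.ofReal_add ht.le (by positivity), ← ENNReal.ofReal_ofNat,
      ← ENNReal.ofReal_mul (by norm_num)]
    congr 1; ring
  rw [Measure.smul_apply, Measure.finsetSum_apply, smul_eq_mul]
  simp only [Measure.smul_apply, smul_eq_mul]
  calc (3 : ℝ≥0∞)⁻¹ * ∑ b ∈ u, f b ≤ 3⁻¹ * (3 * ENNReal.ofReal t) := mul_le_mul_right hall _
    _ = ENNReal.ofReal t := by
      rw [← mul_assoc, ENNReal.inv_mul_cancel (by norm_num) (by norm_num), one_mul]

theorem IsOneFrostman.measure_lt_top_of_isBounded {ν : Measure X} (hν : IsOneFrostman ν)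
    {γ : Set X} (hγ : Bornology.IsBounded γ) : ν γ < ∞ := by
  rcases γ.eq_empty_or_nonempty with rfl | ⟨x, _⟩
  · simp
  obtain ⟨R, hR⟩ := hγ.subset_ball x
  exact (measure_mono hR).trans_lt ((hν x R).trans_lt ENNReal.ofReal_lt_top)

end Gluing

/-! ### Pulling Frostman measures back to the dense set -/

section PullBack

variable {X : Type*} [MetricSpace X] [MeasurableSpace X] [BorelSpace X]

/-- The set `S` carries mass at least `m` of a Frostman measure that is supported on a continuum of
length at most `L`. -/
def CarriesFrostmanMeasure (S : Set X) (L m : ℝ) : Prop :=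
  ∃ (γ : Set X) (ν : Measure X), IsContinuum γ ∧ μH[1] γ ≤ ENNReal.ofReal L ∧
    IsOneFrostman ν ∧ ν γᶜ = 0 ∧ ENNReal.ofReal m ≤ ν S

/-- A Frostman measure on the union of the doubled balls `ball y (2 s)` of a family can be pulled
back to a set `S` that carries Frostman measures, with comparable mass, in all balls `ball y s` of
the family. -/
theorem CarriesFrostmanMeasure.pullback [ProperSpace X] {Q : ℝ≥0}
    (hQ : ∀ x y : X, ∃ γ : Path x y,
      eVariationOn (fun t : unitInterval => γ t) univ ≤ (Q : ℝ≥0∞) * edist x y)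
    {S : Set X} {G : Set (X × ℝ)} {c ρ L m : ℝ} (hc : 0 < c) (hm : 0 < m)
    (hρ : ∀ b ∈ G, 0 < b.2 ∧ b.2 ≤ ρ) (hρL : ρ ≤ L)
    (hG : ∀ b ∈ G, ∃ (γ : Set X) (ν : Measure X), IsContinuum γ ∧ γ ⊆ ball b.1 b.2 ∧
      μH[1] γ ≤ ENNReal.ofReal b.2 ∧ IsOneFrostman ν ∧ ν γᶜ = 0 ∧ ENNReal.ofReal (c * b.2) ≤ ν S)
    (h : CarriesFrostmanMeasure (⋃ b ∈ G, ball b.1 (2 * b.2)) L m) :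
    CarriesFrostmanMeasure S ((2 + 3 * Q) * L) (c / 126 * m) := by
  classical
  obtain ⟨γ, ν, hγ, hγL, hν, hνγ, hνm⟩ := h
  set U : Set X := ⋃ b ∈ G, ball b.1 (2 * b.2) with hU
  have hUo : IsOpen U := isOpen_biUnion fun _ _ => isOpen_ball
  have hfin : IsFiniteMeasure ν := ⟨by
    rw [← union_compl_self γ]
    refine (measure_union_le _ _).trans_lt ?_
    rw [hνγ, add_zero]
    exact hν.measure_lt_top_of_isBounded hγ.1.isBounded⟩
  -- Half of the mass is given up for compactness: only finitely many continua are then attached, so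
  -- the union stays compact.
  obtain ⟨K, hKU, hK, hKm⟩ : ∃ K ⊆ U, IsCompact K ∧ ENNReal.ofReal (m / 2) < ν K :=
    hUo.exists_lt_isCompact (((ENNReal.ofReal_lt_ofReal_iff hm).2 (half_lt_self hm)).trans_le hνm)
  have hKγ : ν (K ∩ γ) = ν K := by
    refine le_antisymm (measure_mono inter_subset_left) ?_
    calc ν K ≤ ν (K ∩ γ ∪ γᶜ) := measure_mono fun x hx => by
          by_cases hxγ : x ∈ γ
          · exact Or.inl ⟨hx, hxγ⟩
          · exact Or.inr hxγ
      _ ≤ ν (K ∩ γ) := by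
          refine (measure_union_le _ _).trans ?_
          rw [hνγ, add_zero]
  have hball : ∀ z ∈ K ∩ γ, ∃ b ∈ G, z ∈ ball b.1 (2 * b.2) := by
    intro z hz
    simpa [hU] using hKU hz.1
  have hlenle : L ≤ (2 + 3 * Q) * L := by
    have hL : 0 ≤ L := by
      obtain ⟨z, hz⟩ : (K ∩ γ).Nonempty := by
        refine nonempty_of_measure_ne_zero (μ := ν) ?_
        rw [hKγ]
        exact (bot_le.trans_lt hKm).ne'
      obtain ⟨b, hb, _⟩ := hball z hz
      exact (hρ b hb).1.le.trans ((hρ b hb).2.trans hρL)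
    have : (0 : ℝ) ≤ Q := Q.2
    nlinarith [mul_nonneg this hL]
  choose! β hβG hβ using hball
  have hcover := (hK.inter_right hγ.1.isClosed).elim_nhds_subcover (fun z => ball z (β z).2)
    fun z hz => ball_mem_nhds z (hρ _ (hβG z hz)).1
  obtain ⟨I, hIK, hIcov⟩ := hcover
  -- If γ fits in one selected ball of radius s, the Frostman bound gives m/2 < s, and the measure
  -- of that single ball has enough mass. Otherwise γ leaves every selected ball and has length at
  -- least s in each; this pays for the attached continua.
  by_cases hsmall : ∃ z ∈ I, γ ⊆ ball z (β z).2
  · obtain ⟨z, hz, hzγ⟩ := hsmall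
    obtain ⟨γ', ν', hγ', _, hlen, hν', hνγ', hmass⟩ := hG _ (hβG z (hIK z hz))
    have hb := hρ _ (hβG z (hIK z hz))
    refine ⟨γ', ν', hγ', hlen.trans (ENNReal.ofReal_le_ofReal ?_), hν', hνγ',
      le_trans (ENNReal.ofReal_le_ofReal ?_) hmass⟩
    · linarith
    · have h1 : ENNReal.ofReal (m / 2) < ENNReal.ofReal (β z).2 := by
        refine hKm.trans_le (le_trans ?_ (hν z (β z).2))
        rw [← hKγ]
        exact measure_mono (inter_subset_right.trans hzγ)
      have h2 := (ENNReal.ofReal_lt_ofReal_iff hb.1).1 h1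
      nlinarith
  push Not at hsmall
  set s : X → ℝ := fun z => (β z).2 with hs
  -- Radius 4s gives the separation that redistribution needs; the fivefold enlargement has radius
  -- 20s.
  obtain ⟨v, hvI, hvdisj, hvcov⟩ :=
    Vitali.exists_disjoint_subfamily_covering_enlargement_closedBall (I : Set X) (fun z => z)
      (fun z => 4 * s z) (4 * ρ)
      (fun z hz => by have := (hρ _ (hβG z (hIK z hz))).2; simp only [hs]; linarith) 5 (by norm_num)
  obtain ⟨u, rfl⟩ := (I.finite_toSet.subset hvI).exists_finset_coe
  have huK : ∀ z ∈ u, z ∈ K ∩ γ := fun z hz => hIK z (hvI hz)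
  have hspos : ∀ z ∈ u, 0 < s z := fun z hz => (hρ _ (hβG z (huK z hz))).1
  choose! E κ hEc hEs hElen hκ hκE hκm using fun z (hz : z ∈ u) => hG _ (hβG z (huK z hz))
  obtain ⟨A, hAm, hAB, hAd, hAun⟩ := exists_measurable_disjoint_refinement u
    (fun z => closedBall z (20 * s z)) fun _ => isClosed_closedBall.measurableSet
  have hAmass : ENNReal.ofReal (m / 2) ≤ ∑ z ∈ u, ν (A z) := by
    rw [← measure_biUnion_finset hAd fun b _ => hAm b, hAun]
    refine hKm.le.trans ?_
    rw [← hKγ]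
    refine measure_mono (hIcov.trans (iUnion₂_subset fun z hz => ?_))
    obtain ⟨b, hb, hzb⟩ := hvcov z hz
    have hz0 := (hρ _ (hβG z (hIK z hz))).1
    refine (ball_subset_closedBall.trans (closedBall_subset_closedBall ?_)).trans
      (hzb.trans ?_)
    · simp only [hs]; linarith
    · rw [← mul_assoc]
      norm_num
      exact subset_biUnion_of_mem (u := fun z => closedBall z (20 * s z)) hb
  have hdist : ∀ z ∈ u, dist z (β z).1 < 2 * s z := fun z hz => hβ z (huK z hz)
  -- Since `z` lies in the doubled ball and `E z` in the ball itself, a connecting path spans a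
  -- distance at most 3s.
  have hpath : ∀ z ∈ u, ∃ F : Set X, IsContinuum F ∧ z ∈ F ∧ (F ∩ E z).Nonempty ∧
      μH[1] F ≤ ENNReal.ofReal (3 * Q * s z) := by
    intro z hz
    obtain ⟨w, hw⟩ := (hEc z hz).2.nonempty
    obtain ⟨p, hp⟩ := hQ z w
    refine ⟨range p, ⟨isCompact_range p.continuous, isConnected_range p.continuous⟩,
      ⟨0, p.source⟩, ⟨w, ⟨1, p.target⟩, hw⟩, p.hausdorffMeasure_range_le.trans (hp.trans ?_)⟩
    have hwz : dist z w ≤ 3 * s z := by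
      have h1 := mem_ball.1 (hEs z hz hw)
      have h2 := hdist z hz
      have h3 := dist_triangle_right z w (β z).1
      simp only [hs] at h2 ⊢
      linarith
    rw [edist_dist, ← ENNReal.ofReal_coe_nnreal, ← ENNReal.ofReal_mul Q.coe_nonneg]
    refine ENNReal.ofReal_le_ofReal ?_
    nlinarith [Q.2]
  choose! F hFc hFz hFE hFlen using hpath
  have hsum : ∑ z ∈ u, ENNReal.ofReal (s z) ≤ ENNReal.ofReal L := by
    calc ∑ z ∈ u, ENNReal.ofReal (s z) ≤ ∑ z ∈ u, μH[1].restrict γ (ball z (s z)) := by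
          refine Finset.sum_le_sum fun z hz => ?_
          rw [Measure.restrict_apply isOpen_ball.measurableSet, inter_comm]
          exact hγ.2.isPreconnected.ofReal_le_hausdorffMeasure_inter_ball (huK z hz).2
            (hsmall z (hvI hz))
      _ = μH[1].restrict γ (⋃ z ∈ u, ball z (s z)) := by
          refine (measure_biUnion_finset (fun a ha b hb hab => ?_)
            fun z _ => isOpen_ball.measurableSet).symm
          refine (hvdisj ha hb hab).mono ?_ ?_ <;>
            exact ball_subset_closedBall.trans (closedBall_subset_closedBall (by
              have := hspos a ha
              have := hspos b hb
              linarith))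
      _ ≤ μH[1].restrict γ univ := measure_mono (subset_univ _)
      _ ≤ ENNReal.ofReal L := by simpa using hγL
  have hFE' : ∀ z ∈ u, IsContinuum (F z ∪ E z) := fun z hz =>
    ⟨(hFc z hz).1.union (hEc z hz).1, (hFc z hz).2.union (hFE z hz) (hEc z hz).2⟩
  refine ⟨γ ∪ ⋃ z ∈ u, (F z ∪ E z),
    (3 : ℝ≥0∞)⁻¹ • ∑ z ∈ u, (ν (A z) / ENNReal.ofReal (21 * s z)) • κ z,
    hγ.union_biUnion u hFE' fun z hz => ⟨z, (huK z hz).2, Or.inl (hFz z hz)⟩,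
    ?_, ?_, ?_, ?_⟩
  · have hL0 : 0 ≤ L := by
      by_contra! hneg
      have : (2 + 3 * (Q : ℝ)) * L < L := by nlinarith [mul_nonneg Q.2 (neg_nonneg.2 hneg.le)]
      linarith
    calc μH[1] (γ ∪ ⋃ z ∈ u, (F z ∪ E z))
        ≤ μH[1] γ + ∑ z ∈ u, μH[1] (F z ∪ E z) :=
          (measure_union_le _ _).trans (add_le_add le_rfl (measure_biUnion_finset_le u _))
      _ ≤ ENNReal.ofReal L + ∑ z ∈ u, ENNReal.ofReal (3 * Q + 1) * ENNReal.ofReal (s z) := by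
          refine add_le_add hγL (Finset.sum_le_sum fun z hz => ?_)
          refine (measure_union_le _ _).trans
            ((add_le_add (hFlen z hz) (hElen z hz)).trans (le_of_eq ?_))
          have := hspos z hz
          rw [← ENNReal.ofReal_add (by positivity) this.le, ← ENNReal.ofReal_mul (by positivity)]
          congr 1; simp only [hs]; ring
      _ ≤ ENNReal.ofReal L + ENNReal.ofReal (3 * Q + 1) * ENNReal.ofReal L := by
          rw [← Finset.mul_sum]; gcongr
      _ = ENNReal.ofReal ((2 + 3 * Q) * L) := by
          rw [← ENNReal.ofReal_mul (by positivity), ← ENNReal.ofReal_add hL0 (by positivity)]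
          congr 1; ring
  · refine hν.redistribute hspos hvdisj hdist hAm (fun z _ => hAB z) hAd hκ fun z hz => ?_
    exact measure_mono_null (compl_subset_compl.2 (hEs z hz)) (hκE z hz)
  · rw [Measure.smul_apply, Measure.finsetSum_apply]
    have : ∀ z ∈ u, κ z (γ ∪ ⋃ z ∈ u, (F z ∪ E z))ᶜ = 0 := fun z hz =>
      measure_mono_null (compl_subset_compl.2 (subset_union_of_subset_right
        (subset_union_right.trans
          (subset_biUnion_of_mem (u := fun z => F z ∪ E z) (show z ∈ u from hz))) _)) (hκE z hz)
    rw [Finset.sum_eq_zero fun z hz => by rw [Measure.smul_apply, this z hz, smul_zero], smul_zero]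
  · rw [Measure.smul_apply, Measure.finsetSum_apply, smul_eq_mul]
    -- 126 = 3 · 21 · 2: the Frostman normalisation, the weights ν(A z)/(21 s z), and the passage to
    -- the compact set.
    calc ENNReal.ofReal (c / 126 * m)
        = 3⁻¹ * (ENNReal.ofReal (c / 21) * ENNReal.ofReal (m / 2)) := by
          rw [← ENNReal.ofReal_mul (by positivity), ← ENNReal.ofReal_ofNat,
            ← ENNReal.ofReal_inv_of_pos (by norm_num), ← ENNReal.ofReal_mul (by norm_num)]
          congr 1; ring
      _ ≤ 3⁻¹ * (ENNReal.ofReal (c / 21) * ∑ z ∈ u, ν (A z)) := by gcongr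
      _ ≤ _ := by
          rw [Finset.mul_sum]
          refine mul_le_mul_right (Finset.sum_le_sum fun z hz => ?_) _
          have hsz := hspos z hz
          rw [Measure.smul_apply, smul_eq_mul]
          refine le_trans (le_of_eq ?_) (mul_le_mul_right (hκm z hz) _)
          rw [mul_comm, div_eq_mul_inv (ν (A z)), mul_assoc,
            ← ENNReal.ofReal_inv_of_pos (by positivity),
            ← ENNReal.ofReal_mul (by positivity)]
          congr 2
          simp only [hs] at hsz ⊢
          field_simp

end PullBack

/-! ### Growth of measure under density enlargement -/

section Growth

variable {X : Type*} [MetricSpace X] [MeasurableSpace X]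

/-- The balls of radius at most `ρ`, as pairs of a centre and a radius, in which `S` has density
larger than `τ`. -/
def denseBalls (μ : Measure X) (τ : ℝ≥0) (ρ : ℝ) (S : Set X) : Set (X × ℝ) :=
  {b | 0 < b.2 ∧ b.2 ≤ ρ ∧ (τ : ℝ≥0∞) * μ (ball b.1 b.2) < μ (S ∩ ball b.1 b.2)}

/-- The union of the doubles of all balls of radius at most `ρ` in which `S` has density larger
than `τ`. -/
def densityEnlargement (μ : Measure X) (τ : ℝ≥0) (ρ : ℝ) (S : Set X) : Set X :=
  ⋃ b ∈ denseBalls μ τ ρ S, ball b.1 (2 * b.2)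

theorem isOpen_densityEnlargement (μ : Measure X) (τ : ℝ≥0) (ρ : ℝ) (S : Set X) :
    IsOpen (densityEnlargement μ τ ρ S) :=
  isOpen_biUnion fun _ _ => isOpen_ball

theorem densityEnlargement_subset_ball {μ : Measure X} {τ : ℝ≥0} {ρ R : ℝ} {S : Set X} {x : X}
    (hS : S ⊆ ball x R) : densityEnlargement μ τ ρ S ⊆ ball x (R + 3 * ρ) := by
  refine iUnion₂_subset fun b hb z hz => ?_
  obtain ⟨w, hwS, hwb⟩ := nonempty_of_measure_ne_zero (bot_le.trans_lt hb.2.2).ne'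
  have h1 := mem_ball.1 (hS hwS)
  have h2 := mem_ball.1 hwb
  have h3 := mem_ball.1 hz
  have h4 := dist_triangle_right z w b.1
  have h5 := dist_triangle z w x
  have h6 := hb.2.1
  rw [mem_ball]
  linarith

/-- If an open set has density at most `τ` in all balls of radius comparable to `ρ`, then the
density enlargement is larger by a definite factor. -/
theorem le_measure_densityEnlargement [BorelSpace X] [SecondCountableTopology X] {μ : Measure X}
    {C : ℝ≥0}
    (hC : ∀ (x : X) (r : ℝ), 0 < r → 0 < μ (ball x r) ∧ μ (ball x r) < ∞ ∧
      μ (ball x (2 * r)) ≤ C * μ (ball x r)) (hC0 : C ≠ 0) {τ : ℝ≥0} (hτ : τ < 1) {ρ : ℝ}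
    (hρ : 0 < ρ) {S : Set X} (hS : IsOpen S)
    (hrad : ∀ b ∈ denseBalls μ τ ρ S, b.2 ≤ ρ / 2) :
    ((1 + (1 - τ) / C ^ 3 : ℝ≥0) : ℝ≥0∞) * μ S ≤ μ (densityEnlargement μ τ ρ S) := by
  -- Stopping-time choice: start from a ball about `y` inside `S`, of density 1, and double until
  -- the ball is no longer dense. By `hrad` the last dense radius is at most ρ/2, so its double is
  -- still admissible in size and can only fail by having density at most τ. That double lies in the
  -- enlargement and has a definite part outside `S`.
  have hsel : ∀ y ∈ S, ∃ s : ℝ, (y, s) ∈ denseBalls μ τ ρ S ∧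
      μ (S ∩ ball y (2 * s)) ≤ τ * μ (ball y (2 * s)) := by
    intro y hy
    obtain ⟨ε, hε, hεS⟩ := Metric.isOpen_iff.1 hS y hy
    set s₀ := min ε ρ with hs₀
    have hs₀pos : 0 < s₀ := lt_min hε hρ
    have h0 : (y, (2 : ℝ) ^ 0 * s₀) ∈ denseBalls μ τ ρ S := by
      rw [pow_zero, one_mul]
      refine ⟨hs₀pos, min_le_right _ _, ?_⟩
      have hsub : S ∩ ball y s₀ = ball y s₀ :=
        inter_eq_right.2 ((ball_subset_ball (min_le_left _ _)).trans hεS)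
      simp only [hsub]
      calc (τ : ℝ≥0∞) * μ (ball y s₀) < 1 * μ (ball y s₀) :=
            ENNReal.mul_lt_mul_left (hC y s₀ hs₀pos).1.ne' (hC y s₀ hs₀pos).2.1.ne
              (by exact_mod_cast hτ)
        _ = _ := one_mul _
    have hex : ∃ n : ℕ, (y, (2 : ℝ) ^ n * s₀) ∉ denseBalls μ τ ρ S := by
      obtain ⟨n, hn⟩ := pow_unbounded_of_one_lt (ρ / s₀) (one_lt_two (α := ℝ))
      exact ⟨n, fun h => absurd h.2.1 (not_le.2 ((div_lt_iff₀ hs₀pos).1 hn))⟩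
    classical
    obtain ⟨n, hn⟩ : ∃ n, Nat.find hex = n + 1 := by
      refine Nat.exists_eq_succ_of_ne_zero fun h => ?_
      exact (h ▸ Nat.find_spec hex) h0
    have hin : (y, (2 : ℝ) ^ n * s₀) ∈ denseBalls μ τ ρ S := by
      have := Nat.find_min hex (m := n) (by omega)
      exact not_not.1 this
    have hout : (y, (2 : ℝ) ^ (n + 1) * s₀) ∉ denseBalls μ τ ρ S := hn ▸ Nat.find_spec hex
    refine ⟨2 ^ n * s₀, hin, ?_⟩
    have hle : 2 * ((2 : ℝ) ^ n * s₀) ≤ ρ := by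
      have := hrad _ hin
      simp only at this
      linarith
    by_contra! hlt
    refine hout ?_
    rw [show (2 : ℝ) ^ (n + 1) * s₀ = 2 * (2 ^ n * s₀) by ring]
    exact ⟨by positivity, hle, hlt⟩
  choose! s hsG hsτ using hsel
  have hspos : ∀ y ∈ S, 0 < s y := fun y hy => (hsG y hy).1
  obtain ⟨u, huS, hdisj, hcov⟩ := Vitali.exists_disjoint_subfamily_covering_enlargement_closedBall
    S (fun y => y) (fun y => 2 * s y) (2 * ρ) (fun y hy => by
      have := (hsG y hy).2.1
      simp only at this
      linarith) 5 (by norm_num)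
  have hdisj' : u.PairwiseDisjoint fun y => ball y (2 * s y) :=
    hdisj.mono fun _ => ball_subset_closedBall
  have hcount : u.Countable := hdisj'.countable_of_isOpen (fun _ _ => isOpen_ball)
    fun b hb => nonempty_ball.2 (by have := hspos b (huS hb); positivity)
  set U := densityEnlargement μ τ ρ S with hU
  have hballU : ∀ y ∈ S, ball y (2 * s y) ⊆ U := fun y hy =>
    subset_biUnion_of_mem (u := fun b : X × ℝ => ball b.1 (2 * b.2)) (hsG y hy)
  have hSU : S ⊆ U := fun y hy =>
    hballU y hy (mem_ball_self (by have := hspos y hy; positivity))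
  have hhole : ∀ y ∈ S,
      ((1 - τ : ℝ≥0) : ℝ≥0∞) * μ (ball y (2 * s y)) ≤ μ (ball y (2 * s y) \ S) := by
    intro y hy
    have hb := hC y (2 * s y) (by have := hspos y hy; positivity)
    rw [ENNReal.coe_sub, ENNReal.sub_mul fun _ _ => hb.2.1.ne, ENNReal.coe_one, one_mul,
      tsub_le_iff_left]
    calc μ (ball y (2 * s y)) = μ (S ∩ ball y (2 * s y)) + μ (ball y (2 * s y) \ S) := by
          rw [inter_comm]; exact (measure_inter_add_sdiff _ hS.measurableSet).symm
      _ ≤ _ := add_le_add (hsτ y hy) le_rfl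
  -- The fivefold Vitali enlargement is absorbed by three doublings, hence C³.
  have hvit : ((1 - τ : ℝ≥0) : ℝ≥0∞) * μ S ≤ (C : ℝ≥0∞) ^ 3 * μ (U \ S) := by
    have hcovS : S ⊆ ⋃ y ∈ u, ball y (2 ^ 3 * (2 * s y)) := by
      intro z hz
      obtain ⟨b, hb, hzb⟩ := hcov z hz
      have hzpos := hspos z hz
      have hbpos := hspos b (huS hb)
      refine mem_iUnion₂.2 ⟨b, hb, ?_⟩
      have := mem_closedBall.1 (hzb (mem_closedBall_self (by positivity)))
      rw [mem_ball]
      linarith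
    calc ((1 - τ : ℝ≥0) : ℝ≥0∞) * μ S
        ≤ ((1 - τ : ℝ≥0) : ℝ≥0∞) * ∑' y : u, (C : ℝ≥0∞) ^ 3 * μ (ball (y : X) (2 * s y)) := by
          gcongr
          refine (measure_mono hcovS).trans ((measure_biUnion_le _ hcount _).trans ?_)
          exact ENNReal.tsum_le_tsum fun y => IsDoublingMeasure.measure_ball_pow_le hC _
            (by have := hspos y (huS y.2); positivity) 3
      _ = (C : ℝ≥0∞) ^ 3 * ∑' y : u, ((1 - τ : ℝ≥0) : ℝ≥0∞) * μ (ball (y : X) (2 * s y)) := by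
          rw [ENNReal.tsum_mul_left, ENNReal.tsum_mul_left]; ring
      _ ≤ (C : ℝ≥0∞) ^ 3 * ∑' y : u, μ (ball (y : X) (2 * s y) \ S) := by
          gcongr with y
          exact hhole y (huS y.2)
      _ = (C : ℝ≥0∞) ^ 3 * μ (⋃ y ∈ u, ball y (2 * s y) \ S) := by
          rw [measure_biUnion hcount (hdisj'.mono fun _ => sdiff_subset)
            fun _ _ => isOpen_ball.measurableSet.diff hS.measurableSet]
      _ ≤ (C : ℝ≥0∞) ^ 3 * μ (U \ S) := by
          gcongr
          exact iUnion₂_subset fun y hy => sdiff_subset_sdiff_left (hballU y (huS hy))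
  have hC3 : (C : ℝ≥0∞) ^ 3 ≠ 0 := by simpa using hC0
  have hC3' : (C : ℝ≥0∞) ^ 3 ≠ ∞ := by simp
  calc ((1 + (1 - τ) / C ^ 3 : ℝ≥0) : ℝ≥0∞) * μ S
      = μ S + ((C : ℝ≥0∞) ^ 3)⁻¹ * (((1 - τ : ℝ≥0) : ℝ≥0∞) * μ S) := by
        rw [ENNReal.coe_add, ENNReal.coe_div (by positivity), ENNReal.coe_pow, ENNReal.coe_one,
          div_eq_mul_inv]
        ring
    _ ≤ μ S + ((C : ℝ≥0∞) ^ 3)⁻¹ * ((C : ℝ≥0∞) ^ 3 * μ (U \ S)) := by gcongr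
    _ = μ S + μ (U \ S) := by rw [← mul_assoc, ENNReal.inv_mul_cancel hC3 hC3', one_mul]
    _ = μ U := by
        rw [← measure_inter_add_sdiff U hS.measurableSet, inter_eq_right.2 hSU]

end Growth

/-! ### Iterating the enlargement: self-improvement of A_∞ -/

section Iteration

variable {X : Type*} [MetricSpace X] [MeasurableSpace X] [BorelSpace X]

theorem CarriesFrostmanMeasure.mono {S : Set X} {L L' m m' : ℝ} (h : CarriesFrostmanMeasure S L m)
    (hL : L ≤ L') (hm : m' ≤ m) : CarriesFrostmanMeasure S L' m' := by
  obtain ⟨γ, ν, h1, h2, h3, h4, h5⟩ := h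
  exact ⟨γ, ν, h1, h2.trans (ENNReal.ofReal_le_ofReal hL), h3, h4,
    (ENNReal.ofReal_le_ofReal hm).trans h5⟩

/-- `S` carries mass at least `c s` of a Frostman measure inside each ball of radius `s ≤ ρ` in
which it has density larger than `τ`. -/
def CarriesInDenseBalls (μ : Measure X) (τ : ℝ≥0) (c ρ : ℝ) : Prop :=
  ∀ S : Set X, IsOpen S → ∀ b ∈ denseBalls μ τ ρ S, ∃ (γ : Set X) (ν : Measure X),
    IsContinuum γ ∧ γ ⊆ ball b.1 b.2 ∧ μH[1] γ ≤ ENNReal.ofReal b.2 ∧ IsOneFrostman ν ∧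
      ν γᶜ = 0 ∧ ENNReal.ofReal (c * b.2) ≤ ν S

/-- `hk` says that `k` growth steps by the factor 1 + (1-τ)/C³ would overfill the ball that contains
all the enlargements, each step moving the boundary by at most 3ρ. So a dense ball of radius above
ρ/2 must occur before step `k`; its measure is pulled back through the earlier steps. -/
theorem carriesFrostmanMeasure_of_pow_lt [ProperSpace X] {μ : Measure X} {C : ℝ≥0}
    (hC : ∀ (x : X) (r : ℝ), 0 < r → 0 < μ (ball x r) ∧ μ (ball x r) < ∞ ∧
      μ (ball x (2 * r)) ≤ C * μ (ball x r)) (hC0 : C ≠ 0) {Q : ℝ≥0}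
    (hQ : ∀ x y : X, ∃ γ : Path x y,
      eVariationOn (fun t : unitInterval => γ t) univ ≤ (Q : ℝ≥0∞) * edist x y)
    {τ : ℝ≥0} (hτ : τ < 1) {c ρ : ℝ} (hc : 0 < c) (hc1 : c ≤ 1) (hρ : 0 < ρ)
    (hcarry : CarriesInDenseBalls μ τ c ρ) (x : X) (k : ℕ) {R : ℝ} {S : Set X} (hS : IsOpen S)
    (hSR : S ⊆ ball x R)
    (hk : μ (ball x (R + 3 * ρ * k)) < ((1 + (1 - τ) / C ^ 3 : ℝ≥0) : ℝ≥0∞) ^ k * μ S) :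
    CarriesFrostmanMeasure S ((2 + 3 * Q) ^ k * ρ) ((c / 126) ^ k * (c / 2 * ρ)) := by
  induction k generalizing R S with
  | zero =>
    simp only [Nat.cast_zero, mul_zero, add_zero, pow_zero, one_mul] at hk
    exact absurd (measure_mono hSR) (not_le.2 hk)
  | succ k ih =>
    have hQ1 : (1 : ℝ) ≤ 2 + 3 * Q := by have := Q.coe_nonneg; linarith
    by_cases hrad : ∀ b ∈ denseBalls μ τ ρ S, b.2 ≤ ρ / 2
    · have hgrow := le_measure_densityEnlargement hC hC0 hτ hρ hS hrad
      have hnext := ih (isOpen_densityEnlargement μ τ ρ S) (densityEnlargement_subset_ball hSR) (by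
        rw [show R + 3 * ρ + 3 * ρ * k = R + 3 * ρ * (k + 1 : ℕ) by push_cast; ring]
        refine hk.trans_le ?_
        rw [pow_succ, mul_assoc]
        gcongr)
      have hpull := CarriesFrostmanMeasure.pullback hQ hc (by positivity)
        (fun b hb => ⟨hb.1, hb.2.1⟩) (le_mul_of_one_le_left hρ.le (one_le_pow₀ hQ1))
        (hcarry S hS) hnext
      convert hpull using 1 <;> ring
    · push Not at hrad
      obtain ⟨b, hb, hbρ⟩ := hrad
      obtain ⟨γ, ν, hγ, _, hlen, hν, hνγ, hm⟩ := hcarry S hS b hb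
      refine CarriesFrostmanMeasure.mono (L := b.2) (m := c * b.2) ⟨γ, ν, hγ, hlen, hν, hνγ, hm⟩
        (hb.2.1.trans (le_mul_of_one_le_left hρ.le (one_le_pow₀ hQ1))) ?_
      have : (c / 126) ^ (k + 1) ≤ 1 := pow_le_one₀ (by positivity) (by linarith)
      calc (c / 126) ^ (k + 1) * (c / 2 * ρ) ≤ 1 * (c / 2 * ρ) := by gcongr
        _ = c * (ρ / 2) := by ring
        _ ≤ c * b.2 := by gcongr

theorem IsAInftyOnCurves.carriesInDenseBalls [SecondCountableTopology X] {μ : Measure X} {τ : ℝ≥0}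
    {θ : ℝ} (hθ : 0 < θ)
    (h : ∀ (x : X) (r : ℝ), 0 < r → ENNReal.ofReal r ≤ ediam (univ : Set X) →
      ∀ S : Set X, MeasurableSet S → S ⊆ ball x r → (τ : ℝ≥0∞) * μ (ball x r) < μ S →
        ∃ γ : Set X, IsContinuum γ ∧ γ ⊆ ball x r ∧ μH[1] γ ≤ ENNReal.ofReal r ∧
          ENNReal.ofReal (θ * r) ≤ hausdorffContentOne (γ ∩ S))
    {ρ : ℝ} (hρ : ENNReal.ofReal ρ ≤ ediam (univ : Set X)) :
    CarriesInDenseBalls μ τ (θ ^ 2 / 40) ρ := by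
  intro S hS b hb
  obtain ⟨γ, hγ, hγb, hlen, hcont⟩ := h b.1 b.2 hb.1
    ((ENNReal.ofReal_le_ofReal hb.2.1).trans hρ) (S ∩ ball b.1 b.2)
    (hS.inter isOpen_ball).measurableSet inter_subset_right hb.2.2
  obtain ⟨ν, hν, hν0, hm⟩ := exists_isOneFrostman_of_content hb.1 hθ hγ.1.measurableSet hlen
    (hS.inter isOpen_ball).measurableSet hcont
  exact ⟨γ, ν, hγ, hγb, hlen, hν,
    measure_mono_null (compl_subset_compl.2 inter_subset_left) hν0,
    hm.trans (measure_mono (inter_subset_right.trans inter_subset_left))⟩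

/-- Self-improvement of the `A_∞` condition on curves: open sets of relative measure `ε` carry
Frostman measures on short continua whose mass is polynomial in `ε`. -/
theorem IsAInftyOnCurves.exists_carriesFrostmanMeasure [CompleteSpace X] {μ : Measure X}
    (hμ : IsDoublingMeasure μ) (hquasi : IsQuasiconvexSpace X) (hA : IsAInftyOnCurves μ) :
    ∃ (c : ℝ) (n : ℕ), 0 < c ∧ ∀ (x : X) (r : ℝ), 0 < r →
      ENNReal.ofReal r ≤ ediam (univ : Set X) → ∀ S : Set X, IsOpen S → S ⊆ ball x r →
        ∀ ε : ℝ, 0 < ε → ε ≤ 1 → ENNReal.ofReal ε * μ (ball x r) ≤ μ S →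
          CarriesFrostmanMeasure S (r / 4) (c * ε ^ n * r) := by
  have := hμ.properSpace
  obtain ⟨C₀, hC₀⟩ := hμ
  obtain ⟨Q, hQ⟩ := hquasi
  obtain ⟨τ, θ, hτ, hθ, h⟩ := hA
  set C : ℝ≥0 := max C₀ 1 with hCdef
  have hC1 : 1 ≤ C := le_max_right _ _
  have hC0 : C ≠ 0 := (zero_lt_one.trans_le hC1).ne'
  have hC : ∀ (x : X) (r : ℝ), 0 < r → 0 < μ (ball x r) ∧ μ (ball x r) < ∞ ∧
      μ (ball x (2 * r)) ≤ C * μ (ball x r) := fun x r hr =>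
    ⟨(hC₀ x r hr).1, (hC₀ x r hr).2.1, (hC₀ x r hr).2.2.trans (by gcongr; exact le_max_left _ _)⟩
  set c : ℝ := min (θ ^ 2 / 40) 1 with hc
  have hcpos : 0 < c := lt_min (by positivity) one_pos
  have hc1 : c ≤ 1 := min_le_right _ _
  set Λ : ℝ≥0 := 1 + (1 - τ) / C ^ 3 with hΛ
  have hΛ1 : (1 : ℝ) < Λ := by
    have : 0 < (1 - τ) / C ^ 3 := div_pos (tsub_pos_of_lt hτ) (by positivity)
    exact_mod_cast lt_add_of_pos_right 1 this
  have hQ0 := Q.coe_nonneg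
  set D : ℝ := 2 + 3 * Q with hD
  have hDpos : 0 < D := by positivity
  set κ : ℝ := c / 126 / D with hκ
  have hκpos : 0 < κ := by positivity
  -- Per step, mass relative to `r` shrinks by κ while measure grows by Λ. Comparing the two through
  -- Λ^(-n) ≤ κ turns an exponential loss in the number of steps into the power ε^n.
  obtain ⟨n, hn⟩ := pow_unbounded_of_one_lt κ⁻¹ hΛ1
  have hΛpos : (0 : ℝ) < Λ := by linarith
  have hCpos : (0 : ℝ) < C := by exact_mod_cast zero_lt_one.trans_le hC1
  refine ⟨c / 8 / (Λ * C) ^ n, n, by positivity, fun x r hr hrX S hS hSr ε hε hε1 hεS => ?_⟩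
  have hCε : 1 ≤ C / ε := by
    rw [le_div_iff₀ hε, one_mul]
    exact hε1.trans (by exact_mod_cast hC1)
  -- Here Λ^j ≤ C/ε < Λ^(j+1): `k = j + 1` steps overfill `ball x (2 * r)`, while Λ^k stays below
  -- ΛC/ε.
  obtain ⟨j, hj1, hj2⟩ := exists_nat_pow_near hCε hΛ1
  set k := j + 1 with hk
  -- The final length D^k ρ is then exactly r/4, and D ≥ 2 keeps all enlargements within `ball x (2
  -- * r)`.
  set ρ : ℝ := r / (4 * D ^ k) with hρ
  have hρpos : 0 < ρ := by positivity
  have hρk : 3 * ρ * k ≤ r := by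
    have h2 : (k : ℝ) ≤ D ^ k := by
      have : (k : ℝ) ≤ 2 ^ k := by exact_mod_cast Nat.lt_two_pow_self.le
      exact this.trans (pow_le_pow_left₀ (by norm_num) (by linarith) k)
    rw [hρ, mul_div_assoc', div_mul_eq_mul_div, div_le_iff₀ (by positivity)]
    nlinarith [mul_le_mul_of_nonneg_left h2 hr.le, mul_pos hr (pow_pos hDpos k)]
  have hρr : ρ ≤ r := by
    rw [hρ, div_le_iff₀ (by positivity)]
    have : 1 ≤ D ^ k := one_le_pow₀ (by linarith)
    nlinarith
  have hcarry : CarriesInDenseBalls μ τ c ρ := by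
    intro S hS b hb
    obtain ⟨γ, ν, h1, h2, h3, h4, h5, h6⟩ := IsAInftyOnCurves.carriesInDenseBalls hθ h
      ((ENNReal.ofReal_le_ofReal hρr).trans hrX) S hS b hb
    refine ⟨γ, ν, h1, h2, h3, h4, h5, (ENNReal.ofReal_le_ofReal ?_).trans h6⟩
    exact mul_le_mul_of_nonneg_right (min_le_left _ _) hb.1.le
  have hball := hC x r hr
  have hmain := carriesFrostmanMeasure_of_pow_lt hC hC0 hQ hτ hcpos hc1 hρpos hcarry x k hS hSr (by
    calc μ (ball x (r + 3 * ρ * k)) ≤ μ (ball x (2 * r)) :=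
          measure_mono (ball_subset_ball (by linarith))
      _ ≤ C * μ (ball x r) := hball.2.2
      _ < (Λ : ℝ≥0∞) ^ k * ENNReal.ofReal ε * μ (ball x r) := by
          refine ENNReal.mul_lt_mul_left hball.1.ne' hball.2.1.ne ?_
          rw [← ENNReal.ofReal_coe_nnreal, ← ENNReal.ofReal_coe_nnreal,
            ← ENNReal.ofReal_pow Λ.coe_nonneg, ← ENNReal.ofReal_mul (by positivity),
            ENNReal.ofReal_lt_ofReal_iff (by positivity)]
          exact (div_lt_iff₀ hε).1 hj2
      _ ≤ (Λ : ℝ≥0∞) ^ k * μ S := by rw [mul_assoc]; gcongr)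
  refine hmain.mono (le_of_eq ?_) ?_
  · rw [hρ, ← hD]; field_simp
  · have hΛk : (Λ : ℝ) ^ k ≤ Λ * C / ε := by
      rw [hk, pow_succ, mul_comm, mul_div_assoc]
      gcongr
    have hκn : ((Λ : ℝ) ^ n)⁻¹ ≤ κ := inv_le_of_inv_le₀ hκpos hn.le
    have hpow : (ε / (Λ * C)) ^ n ≤ κ ^ k := by
      calc (ε / (Λ * C)) ^ n ≤ (((Λ : ℝ) ^ k)⁻¹) ^ n := by
            gcongr
            rw [← inv_div]
            exact inv_anti₀ (by positivity) hΛk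
        _ = (((Λ : ℝ) ^ n)⁻¹) ^ k := by
            rw [inv_pow, inv_pow, ← pow_mul, ← pow_mul, mul_comm]
        _ ≤ κ ^ k := by gcongr
    calc c / 8 / (Λ * C) ^ n * ε ^ n * r = c / 8 * r * (ε / (Λ * C)) ^ n := by
          rw [div_pow]; ring
      _ ≤ c / 8 * r * κ ^ k := by gcongr
      _ = (c / 126) ^ k * (c / 2 * ρ) := by
          rw [hρ, hκ, div_pow]; field_simp; norm_num

end Iteration

/-! ### A packing substitute for length, stable under Hausdorff limits -/

section BoxCounting

variable {Y : Type*} [MetricSpace Y]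

/-- Every `δ`-separated finite subset of `γ` has at most `2 ℓ / δ + 1` points. -/
def HasBoxBound (γ : Set Y) (ℓ : ℝ) : Prop :=
  ∀ δ : ℝ, 0 < δ → ∀ t : Finset Y, (t : Set Y) ⊆ γ →
    (t : Set Y).Pairwise (fun x y => δ ≤ dist x y) → t.card * δ ≤ 2 * ℓ + δ

/-- Balls of radius δ/2 about separated points are disjoint, and a connected set through two or more
of these points has length at least δ/2 in each. The summand δ in the bound accounts for a single
point. -/
theorem IsPreconnected.hasBoxBound [MeasurableSpace Y] [BorelSpace Y] {γ : Set Y}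
    (hγ : IsPreconnected γ) {ℓ : ℝ} (hℓ : 0 ≤ ℓ) (hlen : μH[1] γ ≤ ENNReal.ofReal ℓ) :
    HasBoxBound γ ℓ := by
  intro δ hδ t htγ ht
  rcases le_or_gt t.card 1 with h1 | h1
  · have : (t.card : ℝ) ≤ 1 := by exact_mod_cast h1
    nlinarith
  have hout : ∀ x ∈ t, ¬ γ ⊆ ball x (δ / 2) := by
    intro x hx hsub
    obtain ⟨y, hy, hyx⟩ := Finset.exists_mem_ne h1 x
    have h2 := ht hy hx hyx
    have h3 := mem_ball.1 (hsub (htγ hy))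
    linarith
  have hsum : ∑ x ∈ t, ENNReal.ofReal (δ / 2) ≤ ENNReal.ofReal ℓ := by
    calc ∑ x ∈ t, ENNReal.ofReal (δ / 2) ≤ ∑ x ∈ t, μH[1].restrict γ (ball x (δ / 2)) := by
          refine Finset.sum_le_sum fun x hx => ?_
          rw [Measure.restrict_apply isOpen_ball.measurableSet, inter_comm]
          exact hγ.ofReal_le_hausdorffMeasure_inter_ball (htγ hx) (hout x hx)
      _ = μH[1].restrict γ (⋃ x ∈ t, ball x (δ / 2)) := by
          refine (measure_biUnion_finset (fun a ha b hb hab => ?_)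
            fun z _ => isOpen_ball.measurableSet).symm
          refine ball_disjoint_ball ?_
          have := ht ha hb hab
          linarith
      _ ≤ μH[1].restrict γ univ := measure_mono (subset_univ _)
      _ ≤ ENNReal.ofReal ℓ := by simpa using hlen
  rw [Finset.sum_const, nsmul_eq_mul, ← ENNReal.ofReal_natCast,
    ← ENNReal.ofReal_mul (by positivity), ENNReal.ofReal_le_ofReal_iff hℓ] at hsum
  linarith

/-- A δ-separated subset of maximal cardinality is a δ-net. Covering by balls of diameter at most 2δ
doubles the packing bound to 4ℓ + 2δ, and δ = ε/2 is arbitrarily small. -/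
theorem HasBoxBound.hausdorffMeasure_le [MeasurableSpace Y] [BorelSpace Y] {γ : Set Y} {ℓ : ℝ}
    (hℓ : 0 ≤ ℓ) (h : HasBoxBound γ ℓ) : μH[1] γ ≤ ENNReal.ofReal (4 * ℓ) := by
  classical
  refine hausdorffMeasure_one_le_of_finite_covers fun ε hε => ?_
  set δ := ε / 2 with hδ
  have hδpos : 0 < δ := by positivity
  set N : Set ℕ := {n | ∃ t : Finset Y, (t : Set Y) ⊆ γ ∧
    (t : Set Y).Pairwise (fun x y => δ ≤ dist x y) ∧ t.card = n} with hN
  have hNne : N.Nonempty := ⟨0, ∅, by simp⟩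
  have hNbdd : BddAbove N := by
    refine ⟨⌈(2 * ℓ + δ) / δ⌉₊, ?_⟩
    rintro n ⟨t, htγ, ht, rfl⟩
    have : (t.card : ℝ) ≤ (2 * ℓ + δ) / δ := (le_div_iff₀ hδpos).2 (h δ hδpos t htγ ht)
    exact_mod_cast this.trans (Nat.le_ceil _)
  obtain ⟨t, htγ, ht, htcard⟩ := Nat.sSup_mem hNne hNbdd
  refine ⟨t.card, fun i => ball (t.equivFin.symm i : Y) δ, fun z hz => ?_, fun i => ?_, ?_⟩
  · have hnear : ∃ x ∈ t, dist z x < δ := by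
      by_contra! hfar
      have hzt : z ∉ t := fun hzt => by
        have := hfar z hzt
        rw [dist_self] at this
        linarith
      have hmem : t.card + 1 ∈ N := by
        refine ⟨insert z t, ?_, ?_, Finset.card_insert_of_notMem hzt⟩
        · rw [Finset.coe_insert]
          exact insert_subset hz htγ
        · rw [Finset.coe_insert]
          exact ht.insert fun b hb _ => ⟨hfar b hb, by rw [dist_comm]; exact hfar b hb⟩
      have := le_csSup hNbdd hmem
      omega
    obtain ⟨x, hx, hzx⟩ := hnear
    refine mem_iUnion.2 ⟨t.equivFin ⟨x, hx⟩, ?_⟩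
    simpa using hzx
  · change ediam (ball (t.equivFin.symm i : Y) δ) ≤ _
    rw [← Metric.eball_ofReal]
    refine ediam_eball_le.trans (le_of_eq ?_)
    rw [← ENNReal.ofReal_ofNat, ← ENNReal.ofReal_mul (by norm_num)]
    congr 1; rw [hδ]; ring
  · calc ∑ i : Fin t.card, ediam (ball (t.equivFin.symm i : Y) δ)
        ≤ ∑ _i : Fin t.card, ENNReal.ofReal (2 * δ) := by
          refine Finset.sum_le_sum fun i _ => ?_
          rw [← Metric.eball_ofReal]
          refine ediam_eball_le.trans (le_of_eq ?_)
          rw [← ENNReal.ofReal_ofNat, ← ENNReal.ofReal_mul (by norm_num)]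
      _ = ENNReal.ofReal (t.card * (2 * δ)) := by
          rw [Finset.sum_const, Finset.card_univ, Fintype.card_fin, nsmul_eq_mul,
            ENNReal.ofReal_mul (p := (t.card : ℝ)) (by positivity), ENNReal.ofReal_natCast]
      _ ≤ ENNReal.ofReal (4 * ℓ) + ENNReal.ofReal ε := by
          rw [← ENNReal.ofReal_add (by positivity) hε.le]
          refine ENNReal.ofReal_le_ofReal ?_
          have := h δ hδpos t htγ ht
          linarith

open TopologicalSpace

/-- A violation is witnessed by finitely many points and a strict inequality. A nearby compact set
has points within η of the witnesses; they are (δ - 2η)-separated and still violate the bound for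
small η. -/
theorem isClosed_setOf_hasBoxBound (ℓ : ℝ) :
    IsClosed {γ : NonemptyCompacts Y | HasBoxBound (γ : Set Y) ℓ} := by
  classical
  rw [← isOpen_compl_iff, isOpen_iff_mem_nhds]
  intro γ hγ
  have hγ' : ¬ HasBoxBound (γ : Set Y) ℓ := hγ
  simp only [HasBoxBound, not_forall, not_le] at hγ'
  obtain ⟨δ, hδ, t, htγ, ht, hlt⟩ := hγ'
  have hη : ∃ η : ℝ, 0 < η ∧ 2 * η < δ ∧ 2 * ℓ + (δ - 2 * η) < t.card * (δ - 2 * η) := by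
    have hcont : ContinuousAt (fun η : ℝ => t.card * (δ - 2 * η) - (2 * ℓ + (δ - 2 * η))) 0 := by
      fun_prop
    have hev := hcont.eventually (lt_mem_nhds (a := 0) (by simp only; linarith))
    have hev2 : ∀ᶠ η : ℝ in 𝓝 0, 2 * η < δ :=
      (by fun_prop : ContinuousAt (fun η : ℝ => 2 * η) 0).eventually
        (gt_mem_nhds (by simpa using hδ))
    have hall : ∀ᶠ η : ℝ in 𝓝[>] 0, 0 < η ∧ 2 * η < δ ∧
        2 * ℓ + (δ - 2 * η) < t.card * (δ - 2 * η) := by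
      filter_upwards [self_mem_nhdsWithin, nhdsWithin_le_nhds hev, nhdsWithin_le_nhds hev2]
        with η h1 h2 h3
      exact ⟨h1, h3, by linarith⟩
    exact hall.exists
  obtain ⟨η, hη, hηδ, hbig⟩ := hη
  have hopen : IsOpen (⋂ x ∈ t, {γ' : NonemptyCompacts Y | ((γ' : Set Y) ∩ ball x η).Nonempty}) :=
    t.finite_toSet.isOpen_biInter fun x _ =>
      NonemptyCompacts.isOpen_inter_nonempty_of_isOpen isOpen_ball
  refine mem_of_superset (hopen.mem_nhds (mem_iInter₂.2 fun x hx =>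
    ⟨x, htγ hx, mem_ball_self hη⟩)) fun γ' hγ' hbox => ?_
  have hsel : ∀ x ∈ t, ∃ w ∈ (γ' : Set Y), dist w x < η := fun x hx => by
    obtain ⟨w, hw, hwx⟩ := mem_iInter₂.1 hγ' x hx
    exact ⟨w, hw, hwx⟩
  choose! f hf hfx using hsel
  have hsep : ∀ x ∈ t, ∀ y ∈ t, x ≠ y → δ - 2 * η ≤ dist (f x) (f y) := by
    intro x hx y hy hxy
    have h1 := ht hx hy hxy
    have h2 := hfx x hx
    have h3 := hfx y hy
    have h4 := dist_triangle4 x (f x) (f y) y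
    rw [dist_comm x (f x)] at h4
    simp only at h1
    linarith
  have hinj : Set.InjOn f t := by
    intro x hx y hy hxy
    by_contra hne
    have := hsep x hx y hy hne
    rw [hxy, dist_self] at this
    linarith
  have := hbox (δ - 2 * η) (by linarith) (t.image f) (by
    rw [Finset.coe_image]
    rintro _ ⟨x, hx, rfl⟩
    exact hf x hx) (by
    rw [Finset.coe_image]
    rintro _ ⟨x, hx, rfl⟩ _ ⟨y, hy, rfl⟩ hne
    exact hsep x hx y hy fun h => hne (h ▸ rfl))
  rw [Finset.card_image_of_injOn hinj] at this
  linarith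

/-- A splitting into disjoint closed parts extends to disjoint open neighbourhoods, which also split
every nearby compact set. -/
theorem isClosed_setOf_isPreconnected :
    IsClosed {γ : NonemptyCompacts Y | IsPreconnected (γ : Set Y)} := by
  rw [← isOpen_compl_iff, isOpen_iff_mem_nhds]
  intro γ hγ
  have hγ' : ¬ IsPreconnected (γ : Set Y) := hγ
  rw [isPreconnected_iff_subset_of_fully_disjoint_closed γ.isCompact.isClosed] at hγ'
  push Not at hγ'
  obtain ⟨u, v, hu, hv, hsub, huv, hnu, hnv⟩ := hγ'
  obtain ⟨U, V, hU, hV, huU, hvV, hUV⟩ := normal_separation hu hv huv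
  obtain ⟨a, ha, hau⟩ := not_subset.1 hnu
  obtain ⟨b, hb, hbv⟩ := not_subset.1 hnv
  have hav : a ∈ v := (hsub ha).resolve_left hau
  have hbu : b ∈ u := (hsub hb).resolve_right hbv
  have h1 := NonemptyCompacts.isOpen_subsets_of_isOpen (hU.union hV)
  have h2 := NonemptyCompacts.isOpen_inter_nonempty_of_isOpen hU
  have h3 := NonemptyCompacts.isOpen_inter_nonempty_of_isOpen hV
  filter_upwards [h1.mem_nhds (hsub.trans (union_subset_union huU hvV)),
    h2.mem_nhds ⟨b, hb, huU hbu⟩, h3.mem_nhds ⟨a, ha, hvV hav⟩] with γ' g1 g2 g3 hconn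
  obtain ⟨z, _, hzU, hzV⟩ := hconn U V hU hV g1 g2 g3
  exact disjoint_left.1 hUV hzU hzV

theorem IsOneFrostman.measure_univ_le [MeasurableSpace Y] [CompactSpace Y] {ν : Measure Y}
    (hν : IsOneFrostman ν) :
    ν univ ≤ ENNReal.ofReal (diam (univ : Set Y) + 1) := by
  rcases isEmpty_or_nonempty Y with hY | ⟨⟨y⟩⟩
  · simp [univ_eq_empty_iff.2 hY]
  · refine (measure_mono fun z _ => ?_).trans (hν y _)
    have := dist_le_diam_of_mem (isCompact_univ (X := Y)).isBounded (mem_univ z) (mem_univ y)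
    rw [mem_ball]; linarith

end BoxCounting

/-! ### Weak* compactness of the Frostman family -/

section CompactFamily

variable {Y : Type*} [MetricSpace Y] [MeasurableSpace Y] [BorelSpace Y]

/-- Mass of an open set is lower semicontinuous: inner regularity and a bump function between a
compact set and `U` bound it below by a weak* continuous functional. -/
theorem isOpen_setOf_lt_measure [CompactSpace Y] {U : Set Y} (hU : IsOpen U) (a : ℝ≥0∞) :
    IsOpen {ν : FiniteMeasure Y | a < (ν : Measure Y) U} := by
  rw [isOpen_iff_mem_nhds]
  intro ν hν
  obtain ⟨F, hFU, hF, haF⟩ := hU.exists_lt_isCompact (μ := (ν : Measure Y)) hν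
  obtain ⟨δ, hδ, hδU⟩ := hF.exists_thickening_subset_open hU hFU
  set f := thickenedIndicator hδ F with hf
  have hcont : Continuous fun ν : FiniteMeasure Y => ((ν.testAgainstNN f : ℝ≥0) : ℝ≥0∞) :=
    ENNReal.continuous_coe.comp (FiniteMeasure.continuous_testAgainstNN_eval f)
  have heq : ∀ ν : FiniteMeasure Y,
      ((ν.testAgainstNN f : ℝ≥0) : ℝ≥0∞) = ∫⁻ y, (f y : ℝ≥0∞) ∂(ν : Measure Y) :=
    fun ν => FiniteMeasure.testAgainstNN_coe_eq
  have hlow : a < ((ν.testAgainstNN f : ℝ≥0) : ℝ≥0∞) := by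
    refine haF.trans_le ?_
    rw [heq, ← lintegral_indicator_one hF.isClosed.measurableSet]
    refine lintegral_mono fun y => ?_
    by_cases hy : y ∈ F
    · simp [hy, hf, thickenedIndicator_one hδ F hy]
    · simp [hy]
  filter_upwards [hcont.continuousAt.eventually (lt_mem_nhds hlow)] with ν' hν'
  refine hν'.trans_le ?_
  rw [heq, ← lintegral_indicator_one hU.measurableSet]
  refine lintegral_mono fun y => ?_
  by_cases hy : y ∈ U
  · rw [indicator_of_mem hy, Pi.one_apply, ← ENNReal.coe_one, ENNReal.coe_le_coe]
    exact thickenedIndicator_le_one hδ F y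
  · simp [hy, hf, thickenedIndicator_zero hδ F fun h => hy (hδU h)]

theorem isClosed_setOf_isOneFrostman [CompactSpace Y] :
    IsClosed {ν : FiniteMeasure Y | IsOneFrostman (ν : Measure Y)} := by
  have : {ν : FiniteMeasure Y | IsOneFrostman (ν : Measure Y)} =
      ⋂ (y : Y) (s : ℝ), {ν : FiniteMeasure Y | ENNReal.ofReal s < (ν : Measure Y) (ball y s)}ᶜ := by
    ext ν
    simp [IsOneFrostman]
  rw [this]
  exact isClosed_iInter fun y => isClosed_iInter fun s =>
    (isOpen_setOf_lt_measure isOpen_ball _).isClosed_compl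

open TopologicalSpace

theorem isClosed_setOf_measure_compl_eq_zero [CompactSpace Y] :
    IsClosed {p : FiniteMeasure Y × NonemptyCompacts Y | (p.1 : Measure Y) (p.2 : Set Y)ᶜ = 0} := by
  rw [← isOpen_compl_iff, isOpen_iff_mem_nhds]
  rintro ⟨ν, γ⟩ hp
  have hpos : 0 < (ν : Measure Y) (γ : Set Y)ᶜ := pos_iff_ne_zero.2 hp
  obtain ⟨F, hFγ, hF, hFpos⟩ :=
    γ.isCompact.isClosed.isOpen_compl.exists_lt_isCompact (μ := (ν : Measure Y)) hpos
  obtain ⟨U, V, hU, hV, hFU, hγV, hUV⟩ := normal_separation hF.isClosed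
    γ.isCompact.isClosed (disjoint_left.2 hFγ)
  have h1 := isOpen_setOf_lt_measure (Y := Y) hU 0
  have h2 := NonemptyCompacts.isOpen_subsets_of_isOpen hV
  filter_upwards [prod_mem_nhds (h1.mem_nhds (hFpos.trans_le (measure_mono hFU)))
    (h2.mem_nhds hγV)] with p hp' hzero
  refine (hp'.1 : 0 < (p.1 : Measure Y) U).ne' (measure_mono_null (fun z hz hzγ => ?_) hzero)
  exact disjoint_left.1 hUV hz (hp'.2 hzγ)

/-- The Frostman measures on `Y` that are supported on a continuum with box counting bound `ℓ`. -/
def boxFrostmanFamily (Y : Type*) [MetricSpace Y] [MeasurableSpace Y] (ℓ : ℝ) :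
    Set (FiniteMeasure Y) :=
  {ν | IsOneFrostman (ν : Measure Y) ∧ ∃ γ : NonemptyCompacts Y, IsPreconnected (γ : Set Y) ∧
    HasBoxBound (γ : Set Y) ℓ ∧ (ν : Measure Y) (γ : Set Y)ᶜ = 0}

/-- With the supporting continuum kept as a second coordinate, all conditions are closed in a
compact product of measures of bounded mass and nonempty compact sets; the family is the projection.
-/
theorem isCompact_boxFrostmanFamily [CompactSpace Y] (ℓ : ℝ) :
    IsCompact (boxFrostmanFamily Y ℓ) := by
  set C : Set (FiniteMeasure Y × NonemptyCompacts Y) :=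
    {p | IsOneFrostman (p.1 : Measure Y) ∧ IsPreconnected (p.2 : Set Y) ∧
      HasBoxBound (p.2 : Set Y) ℓ ∧ (p.1 : Measure Y) (p.2 : Set Y)ᶜ = 0} with hC
  have hCclosed : IsClosed C :=
    (isClosed_setOf_isOneFrostman.preimage continuous_fst).inter
      ((isClosed_setOf_isPreconnected.preimage continuous_snd).inter
        (((isClosed_setOf_hasBoxBound ℓ).preimage continuous_snd).inter
          isClosed_setOf_measure_compl_eq_zero))
  have hcomp : IsCompact C := by
    refine ((isCompact_setOfPred_finiteMeasure_le_of_compactSpace Y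
      (Real.toNNReal (diam (univ : Set Y) + 1))).prod
      (isCompact_univ (X := NonemptyCompacts Y))).of_isClosed_subset hCclosed fun p hp => ?_
    refine ⟨?_, mem_univ _⟩
    have := hp.1.measure_univ_le
    rw [← FiniteMeasure.ennreal_mass] at this
    exact ENNReal.coe_le_coe.1 this
  have himg : boxFrostmanFamily Y ℓ = Prod.fst '' C := by
    ext ν
    constructor
    · rintro ⟨h1, γ, h2, h3, h4⟩
      exact ⟨(ν, γ), ⟨h1, h2, h3, h4⟩, rfl⟩
    · rintro ⟨⟨ν, γ⟩, ⟨h1, h2, h3, h4⟩, rfl⟩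
      exact ⟨h1, γ, h2, h3, h4⟩
  rw [himg]
  exact hcomp.image continuous_fst

end CompactFamily

/-! ### Passing from the space to the closed doubled ball -/

section Transfer

variable {X : Type*} [MetricSpace X] [MeasurableSpace X] [BorelSpace X]

/-- A Frostman measure carried by an open subset of a ball, on a short continuum, is a measure of
the compact family on the closure of the doubled ball. -/
theorem CarriesFrostmanMeasure.exists_mem_boxFrostmanFamily {x : X} {r m : ℝ} (hr : 0 < r)
    (hm : 0 < m) (hcomp : IsCompact (closure (ball x (2 * r)))) {S : Set X}
    (hSr : S ⊆ ball x r) (h : CarriesFrostmanMeasure S (r / 4) m) :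
    ∃ ν ∈ boxFrostmanFamily (closure (ball x (2 * r))) (r / 4),
      ENNReal.ofReal m ≤ (ν : Measure (closure (ball x (2 * r)))) (Subtype.val ⁻¹' S) := by
  classical
  obtain ⟨γ, ν, hγ, hlen, hν, hνγ, hνm⟩ := h
  set T := closure (ball x (2 * r)) with hT
  have hTm : MeasurableSet T := isClosed_closure.measurableSet
  have : CompactSpace T := isCompact_iff_compactSpace.1 hcomp
  obtain ⟨p, hpS, hpγ⟩ : (S ∩ γ).Nonempty := by
    by_contra hempty
    have hsub : S ⊆ γᶜ := fun z hz hzγ => hempty ⟨z, hz, hzγ⟩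
    have h0 : ν S = 0 := measure_mono_null hsub hνγ
    rw [h0, nonpos_iff_eq_zero, ENNReal.ofReal_eq_zero] at hνm
    linarith
  -- A continuum of length at most r/4 cannot leave a ball of radius r about one of its points; `p`
  -- lies in `ball x r`, so γ stays in the doubled ball.
  have hγp : γ ⊆ ball p r := by
    by_contra hout
    have h1 := (hγ.2.isPreconnected.ofReal_le_hausdorffMeasure_inter_ball hpγ hout).trans
      ((measure_mono inter_subset_left).trans hlen)
    rw [ENNReal.ofReal_le_ofReal_iff (by positivity)] at h1
    linarith
  have hγT : γ ⊆ T := by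
    refine (hγp.trans (ball_subset_ball' ?_)).trans subset_closure
    have := mem_ball.1 (hSr hpS)
    linarith
  have hemb := MeasurableEmbedding.subtype_coe hTm
  set κ : Measure T := ν.comap Subtype.val with hκ
  have hκapp : ∀ A : Set T, κ A = ν (Subtype.val '' A) := fun A => hemb.comap_apply ν A
  have hκF : IsOneFrostman κ := by
    intro y s
    rw [hκapp]
    refine (measure_mono ?_).trans (hν y s)
    rintro _ ⟨z, hz, rfl⟩
    exact hz
  have hfin : IsFiniteMeasure κ := ⟨hκF.measure_univ_le.trans_lt ENNReal.ofReal_lt_top⟩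
  have himg : (Subtype.val : T → X) '' (Subtype.val ⁻¹' γ) = γ := by
    rw [Subtype.image_preimage_coe, inter_eq_right.2 hγT]
  have hconn : IsPreconnected ((Subtype.val : T → X) ⁻¹' γ) := by
    rw [← Topology.IsInducing.subtypeVal.isPreconnected_image, himg]
    exact hγ.2.isPreconnected
  have hbox : HasBoxBound ((Subtype.val : T → X) ⁻¹' γ) (r / 4) := by
    intro δ hδ t htγ ht
    have := hγ.2.isPreconnected.hasBoxBound (by positivity) hlen δ hδ
      (t.map (Function.Embedding.subtype _)) (by
        rw [Finset.coe_map]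
        rintro _ ⟨z, hz, rfl⟩
        exact htγ hz) (by
        rw [Finset.coe_map]
        rintro _ ⟨z, hz, rfl⟩ _ ⟨w, hw, rfl⟩ hne
        exact ht hz hw fun h => hne (h ▸ rfl))
    rwa [Finset.card_map] at this
  refine ⟨⟨κ, hfin⟩, ⟨hκF, ⟨⟨Subtype.val ⁻¹' γ, ?_⟩, ?_⟩, hconn, hbox, ?_⟩, ?_⟩
  · exact (hγ.1.isClosed.preimage continuous_subtype_val).isCompact
  · obtain ⟨z, hz⟩ := hγ.2.nonempty
    exact ⟨⟨z, hγT hz⟩, hz⟩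
  · change κ (Subtype.val ⁻¹' γ)ᶜ = 0
    rw [hκapp]
    refine measure_mono_null ?_ hνγ
    rintro _ ⟨z, hz, rfl⟩
    exact hz
  · change _ ≤ κ (Subtype.val ⁻¹' S)
    rw [hκapp, Subtype.image_preimage_coe, inter_eq_right.2
      ((hSr.trans (ball_subset_ball (by linarith))).trans subset_closure)]
    exact hνm

end Transfer

/-! ### A minimax principle for probability measures -/

section Minimax

/-- If every convex combination of a family of continuous functions on a compact space is
nonnegative somewhere, then all the functions have nonnegative mean for a single probability
measure. -/
theorem exists_probabilityMeasure_forall_integral_nonneg {K ι : Type*} [TopologicalSpace K]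
    [CompactSpace K] [T2Space K] [MeasurableSpace K] [BorelSpace K] [Nonempty K] (G : ι → C(K, ℝ))
    (h : ∀ (t : Finset ι) (w : ι → ℝ), (∀ i ∈ t, 0 ≤ w i) → ∑ i ∈ t, w i = 1 →
      ∃ k, 0 ≤ ∑ i ∈ t, w i * G i k) :
    ∃ P : ProbabilityMeasure K, ∀ i, 0 ≤ ∫ k, G i k ∂(P : Measure K) := by
  classical
  have hcont : ∀ i, Continuous fun P : ProbabilityMeasure K => ∫ k, G i k ∂(P : Measure K) :=
    fun i => ProbabilityMeasure.continuous_integral_boundedContinuousFunction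
      (BoundedContinuousFunction.mkOfCompact (G i))
  have hint : ∀ (i : ι) (P : Measure K) [IsFiniteMeasure P], Integrable (fun k => G i k) P :=
    fun i P _ => (BoundedContinuousFunction.mkOfCompact (G i)).integrable P
  suffices hne : (⋂ i, {P : ProbabilityMeasure K | 0 ≤ ∫ k, G i k ∂(P : Measure K)}).Nonempty by
    obtain ⟨P, hP⟩ := hne
    exact ⟨P, fun i => mem_iInter.1 hP i⟩
  -- The space of probability measures is compact, so finitely many functions suffice. The
  -- achievable vectors of means form a compact convex set; if it misses the nonnegative orthant, it
  -- can be separated from it.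
  refine CompactSpace.iInter_nonempty (fun i => isClosed_le continuous_const (hcont i)) fun t => ?_
  by_contra hempty
  set Φ : ProbabilityMeasure K → (t → ℝ) := fun P i => ∫ k, G i k ∂(P : Measure K) with hΦ
  have hΦc : Continuous Φ := continuous_pi fun i => hcont i
  have hconv : Convex ℝ (range Φ) := by
    rintro _ ⟨P, rfl⟩ _ ⟨Q, rfl⟩ a b ha hb hab
    have hprob : IsProbabilityMeasure
        (ENNReal.ofReal a • (P : Measure K) + ENNReal.ofReal b • (Q : Measure K)) := ⟨by
      simp [← ENNReal.ofReal_add ha hb, hab]⟩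
    refine ⟨⟨_, hprob⟩, funext fun i => ?_⟩
    change ∫ k, G i k ∂(ENNReal.ofReal a • (P : Measure K) + ENNReal.ofReal b • (Q : Measure K)) = _
    rw [integral_add_measure ((hint i _).smul_measure ENNReal.ofReal_ne_top)
      ((hint i _).smul_measure ENNReal.ofReal_ne_top), integral_smul_measure,
      integral_smul_measure, ENNReal.toReal_ofReal ha, ENNReal.toReal_ofReal hb]
    rfl
  set D : Set (t → ℝ) := {v | ∀ i, 0 ≤ v i} with hD
  have hDconv : Convex ℝ D := fun v hv w hw a b ha hb _ i =>
    add_nonneg (mul_nonneg ha (hv i)) (mul_nonneg hb (hw i))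
  have hDclosed : IsClosed D := by
    rw [hD, ofPred_forall]
    exact isClosed_iInter fun i => isClosed_le continuous_const (continuous_apply i)
  have hdisj : Disjoint (range Φ) D := by
    rw [Set.disjoint_left]
    rintro _ ⟨P, rfl⟩ hP
    exact hempty ⟨P, mem_iInter₂.2 fun i hi => hP ⟨i, hi⟩⟩
  obtain ⟨f, u, v, hfu, huv, hvf⟩ := geometric_hahn_banach_compact_closed hconv
    (isCompact_range hΦc) hDconv hDclosed hdisj
  have hv0 : v < 0 := by simpa using hvf 0 fun i => le_rfl
  set w : ι → ℝ := fun i => if hi : i ∈ t then f (Pi.single ⟨i, hi⟩ 1) else 0 with hw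
  have hwt : ∀ i : t, w i = f (Pi.single i 1) := fun i => by simp [hw]
  have hfsum : ∀ g : ι → ℝ, f (fun i : t => g i) = ∑ i ∈ t, w i * g i := by
    intro g
    rw [← Finset.sum_coe_sort t fun i => w i * g i]
    conv_lhs => rw [← Finset.univ_sum_single (fun i : t => g i)]
    rw [map_sum]
    refine Finset.sum_congr rfl fun i _ => ?_
    rw [hwt, mul_comm, ← smul_eq_mul, ← map_smul, ← Pi.single_smul', smul_eq_mul, mul_one]
  -- A negative coefficient would let the functional attain the value `v` on the orthant, where it
  -- exceeds `v`.
  have hw0 : ∀ i ∈ t, 0 ≤ w i := by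
    intro i hi
    by_contra! hneg
    have hb := hvf (Pi.single ⟨i, hi⟩ (v / w i)) fun j => by
      rcases eq_or_ne j ⟨i, hi⟩ with rfl | hj
      · simpa using (div_pos_of_neg_of_neg hv0 hneg).le
      · simp [hj]
    rw [show (Pi.single (⟨i, hi⟩ : t) (v / w i) : t → ℝ) =
      (v / w i) • Pi.single ⟨i, hi⟩ 1 by rw [← Pi.single_smul', smul_eq_mul, mul_one], map_smul,
      ← hwt ⟨i, hi⟩, smul_eq_mul, div_mul_cancel₀ _ hneg.ne] at hb
    exact lt_irrefl _ hb
  -- Dirac masses turn the separation into a pointwise statement: the weighted sum is negative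
  -- everywhere.
  have hdirac : ∀ k : K, ∑ i ∈ t, w i * G i k < 0 := by
    intro k
    have := hfu (Φ ⟨Measure.dirac k, inferInstance⟩) ⟨_, rfl⟩
    have heq : Φ ⟨Measure.dirac k, inferInstance⟩ = fun i : t => G i k := by
      funext i
      exact integral_dirac _ _
    rw [heq, hfsum fun i => G i k] at this
    linarith
  have hW : 0 < ∑ i ∈ t, w i := by
    refine (Finset.sum_nonneg hw0).lt_of_ne fun h0 => ?_
    have hz := (Finset.sum_eq_zero_iff_of_nonneg hw0).1 h0.symm
    have := hdirac (Classical.arbitrary K)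
    rw [Finset.sum_eq_zero fun i hi => by rw [hz i hi, zero_mul]] at this
    exact lt_irrefl _ this
  obtain ⟨k, hk⟩ := h t (fun i => w i / ∑ j ∈ t, w j) (fun i hi => div_nonneg (hw0 i hi) hW.le)
    (by rw [← Finset.sum_div, div_self hW.ne'])
  have hk' : ∑ i ∈ t, w i / (∑ j ∈ t, w j) * G i k = (∑ i ∈ t, w i * G i k) / ∑ j ∈ t, w j := by
    rw [Finset.sum_div]
    exact Finset.sum_congr rfl fun i _ => by ring
  rw [hk'] at hk
  exact absurd hk (not_le.2 (div_neg_of_neg_of_pos (hdirac k) hW))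

end Minimax

/-! ### From test-function inequalities to density bounds -/

section Duality

variable {Y : Type*} [MeasurableSpace Y]

theorem Measurable.integrable_of_mem_Icc {μ : Measure Y} [IsFiniteMeasure μ] {f : Y → ℝ}
    (hf : Measurable f) {N : ℝ} (hN : ∀ y, f y ∈ Icc 0 N) : Integrable f μ :=
  Integrable.of_bound hf.aestronglyMeasurable N (Eventually.of_forall fun y => by
    rw [Real.norm_eq_abs, abs_of_nonneg (hN y).1]; exact (hN y).2)

/-- On an η-null set E the functions n·1_E make the last term vanish, so n σ(E) ≤ B for every n. -/
theorem absolutelyContinuous_of_integral_le {σ η : Measure Y} [IsFiniteMeasure σ]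
    {B : ℝ} {q : ℕ} (hq : q ≠ 0)
    (h : ∀ f : Y → ℝ, Measurable f → ∀ N : ℝ, (∀ y, f y ∈ Icc 0 N) →
      ∫ y, f y ∂σ ≤ B + 1 / 2 * ∫ y, f y ^ q ∂η) : σ ≪ η := by
  refine Measure.AbsolutelyContinuous.mk fun E hE hηE => ?_
  have key : ∀ n : ℕ, n * σ.real E ≤ B := by
    intro n
    have := h (E.indicator fun _ => (n : ℝ)) (measurable_const.indicator hE) n fun y => by
      by_cases hy : y ∈ E <;> simp [hy]
    rw [integral_indicator_const _ hE, smul_eq_mul] at this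
    have hz : ∫ y, (E.indicator (fun _ => (n : ℝ)) y) ^ q ∂η = 0 := by
      refine integral_eq_zero_of_ae ?_
      filter_upwards [measure_eq_zero_iff_ae_notMem.1 hηE] with y hy
      simp [hy, hq]
    rw [hz] at this
    linarith
  have hzero : σ.real E = 0 := by
    by_contra hne
    have hpos : 0 < σ.real E := lt_of_le_of_ne measureReal_nonneg (Ne.symm hne)
    obtain ⟨n, hn⟩ := exists_nat_gt (B / σ.real E)
    exact absurd (key n) (not_le.2 ((div_lt_iff₀ hpos).1 hn))
  rwa [measureReal_eq_zero_iff] at hzero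

/-- Let g be the density and test with f = min(g,n)^(1/(q-1)). Then f^q = min(g,n)^p and ∫ f dσ = ∫
g f dη ≥ ∫ min(g,n)^p dη =: J. Hence J ≤ B + J/2; truncation makes J finite, so J ≤ 2B, and Fatou
removes the truncation. -/
theorem lintegral_rnDeriv_rpow_le {σ η : Measure Y} [IsFiniteMeasure σ]
    [IsFiniteMeasure η] {B : ℝ} {q : ℕ} (hq : 2 ≤ q)
    (h : ∀ f : Y → ℝ, Measurable f → ∀ N : ℝ, (∀ y, f y ∈ Icc 0 N) →
      ∫ y, f y ∂σ ≤ B + 1 / 2 * ∫ y, f y ^ q ∂η) :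
    ∫⁻ y, σ.rnDeriv η y ^ ((q : ℝ) / (q - 1)) ∂η ≤ ENNReal.ofReal (2 * B) := by
  have hac := absolutelyContinuous_of_integral_le (by omega) h
  have hq2 : (2 : ℝ) ≤ q := by exact_mod_cast hq
  have hq1 : (0 : ℝ) < q - 1 := by linarith
  set p : ℝ := q / (q - 1) with hp
  have hppos : 0 < p := by positivity
  set g : Y → ℝ := fun y => (σ.rnDeriv η y).toReal with hg
  have hgm : Measurable g := (Measure.measurable_rnDeriv σ η).ennreal_toReal
  have hg0 : ∀ y, 0 ≤ g y := fun y => ENNReal.toReal_nonneg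
  have hmin0 : ∀ (n : ℕ) (y : Y), 0 ≤ min (g y) n := fun n y => le_min (hg0 y) n.cast_nonneg
  have hminm : ∀ n : ℕ, Measurable fun y => min (g y) (n : ℝ) := fun n => hgm.min measurable_const
  have hpowm : ∀ (n : ℕ) (a : ℝ), Measurable fun y => min (g y) (n : ℝ) ^ a := fun n a =>
    (hminm n).pow_const a
  have hpowb : ∀ (n : ℕ) (a : ℝ), 0 ≤ a → ∀ y, min (g y) (n : ℝ) ^ a ∈ Icc 0 ((n : ℝ) ^ a) :=
    fun n a ha y => ⟨Real.rpow_nonneg (hmin0 n y) a,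
      Real.rpow_le_rpow (hmin0 n y) (min_le_right _ _) ha⟩
  have hJ : ∀ n : ℕ, ∫ y, min (g y) (n : ℝ) ^ p ∂η ≤ 2 * B := by
    intro n
    have h1 := h _ (hpowm n (q - 1 : ℝ)⁻¹) _ (hpowb n _ (by positivity))
    have hpq : ∀ y, (min (g y) (n : ℝ) ^ (q - 1 : ℝ)⁻¹) ^ q = min (g y) (n : ℝ) ^ p := by
      intro y
      rw [← Real.rpow_natCast, ← Real.rpow_mul (hmin0 n y)]
      congr 1
      rw [hp]; field_simp
    simp only [hpq] at h1
    have h2 : ∫ y, min (g y) (n : ℝ) ^ p ∂η ≤ ∫ y, min (g y) (n : ℝ) ^ (q - 1 : ℝ)⁻¹ ∂σ := by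
      rw [← integral_rnDeriv_smul hac]
      refine integral_mono ((hpowm n p).integrable_of_mem_Icc (hpowb n p hppos.le)) ?_ fun y => ?_
      · rw [integrable_rnDeriv_smul_iff hac]
        exact (hpowm n _).integrable_of_mem_Icc (hpowb n _ (by positivity))
      · rw [smul_eq_mul]
        have hsplit : p = 1 + (q - 1 : ℝ)⁻¹ := by rw [hp]; field_simp; ring
        rw [hsplit, Real.rpow_one_add' (hmin0 n y) (by positivity)]
        exact mul_le_mul_of_nonneg_right (min_le_left _ _) (Real.rpow_nonneg (hmin0 n y) _)
    linarith
  have hJ' : ∀ n : ℕ, ∫⁻ y, ENNReal.ofReal (min (g y) (n : ℝ) ^ p) ∂η ≤ ENNReal.ofReal (2 * B) := by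
    intro n
    rw [← ofReal_integral_eq_lintegral_ofReal
      ((hpowm n p).integrable_of_mem_Icc (hpowb n p hppos.le))
      (Eventually.of_forall fun y => Real.rpow_nonneg (hmin0 n y) p)]
    exact ENNReal.ofReal_le_ofReal (hJ n)
  calc ∫⁻ y, σ.rnDeriv η y ^ p ∂η
      = ∫⁻ y, liminf (fun n : ℕ => ENNReal.ofReal (min (g y) (n : ℝ) ^ p)) atTop ∂η := by
        refine lintegral_congr_ae ?_
        filter_upwards [Measure.rnDeriv_lt_top σ η] with y hy
        have hlim : Tendsto (fun n : ℕ => ENNReal.ofReal (min (g y) (n : ℝ) ^ p)) atTop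
            (𝓝 (σ.rnDeriv η y ^ p)) := by
          refine tendsto_const_nhds.congr' ?_
          filter_upwards [eventually_ge_atTop ⌈g y⌉₊] with n hn
          rw [min_eq_left ((Nat.le_ceil _).trans (by exact_mod_cast hn)),
            ← ENNReal.ofReal_rpow_of_nonneg (hg0 y) hppos.le, hg, ENNReal.ofReal_toReal hy.ne]
        exact hlim.liminf_eq.symm
    _ ≤ liminf (fun n : ℕ => ∫⁻ y, ENNReal.ofReal (min (g y) (n : ℝ) ^ p) ∂η) atTop :=
        lintegral_liminf_le fun n => (hpowm n p).ennreal_ofReal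
    _ ≤ ENNReal.ofReal (2 * B) :=
        liminf_le_of_frequently_le' (Eventually.of_forall hJ').frequently

/-- An inequality between `∫ φ dσ` and `∫ φ ^ q dη` extends from continuous to bounded measurable
nonnegative functions. -/
theorem integral_le_of_forall_continuous [MetricSpace Y] [BorelSpace Y] [CompactSpace Y]
    {σ η : Measure Y} [IsFiniteMeasure σ] [IsFiniteMeasure η] {B : ℝ} {q : ℕ}
    (h : ∀ φ : C(Y, ℝ), 0 ≤ φ → ∫ y, φ y ∂σ ≤ B + 1 / 2 * ∫ y, φ y ^ q ∂η) {f : Y → ℝ}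
    (hf : Measurable f) {N : ℝ} (hN : ∀ y, f y ∈ Icc 0 N) :
    ∫ y, f y ∂σ ≤ B + 1 / 2 * ∫ y, f y ^ q ∂η := by
  rcases isEmpty_or_nonempty Y with hY | ⟨⟨y₀⟩⟩
  · have := h 0 le_rfl
    simp only [integral_of_isEmpty] at this ⊢
    exact this
  have hN0 : 0 ≤ N := (hN y₀).1.trans (hN y₀).2
  have hfpow : ∀ y, f y ^ q ∈ Icc 0 (N ^ q) := fun y =>
    ⟨pow_nonneg (hN y).1 q, pow_le_pow_left₀ (hN y).1 (hN y).2 q⟩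
  refine le_of_forall_pos_le_add fun ε hε => ?_
  -- On [0,N] the q-th power is Lipschitz with constant q N^(q-1), so an L¹(σ + η) error of ε/D
  -- costs at most ε in both integrals together.
  set D : ℝ := 1 + q * N ^ (q - 1) with hD
  have hDpos : 0 < D := by positivity
  obtain ⟨g, hg, hgi⟩ := (hf.integrable_of_mem_Icc (μ := σ + η)
    hN).exists_boundedContinuous_integral_sub_le (div_pos hε hDpos)
  set ψ : C(Y, ℝ) := ⟨fun y => max (min (g y) N) 0, by fun_prop⟩ with hψ
  have hψN : ∀ y, ψ y ∈ Icc 0 N := fun y =>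
    ⟨le_max_right _ _, max_le (min_le_right _ _) hN0⟩
  have hψm : Measurable ψ := ψ.continuous.measurable
  have hψpow : ∀ y, ψ y ^ q ∈ Icc 0 (N ^ q) := fun y =>
    ⟨pow_nonneg (hψN y).1 q, pow_le_pow_left₀ (hψN y).1 (hψN y).2 q⟩
  have hclose : ∀ y, |f y - ψ y| ≤ ‖f y - g y‖ := by
    intro y
    have h1 : f y = max (min (f y) N) 0 := by
      rw [min_eq_left (hN y).2, max_eq_left (hN y).1]
    calc |f y - ψ y| = |max (min (f y) N) 0 - max (min (g y) N) 0| := by rw [← h1]; rfl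
      _ ≤ |min (f y) N - min (g y) N| := abs_max_sub_max_le_abs _ _ _
      _ ≤ max |f y - g y| |N - N| := abs_min_sub_min_le_max _ _ _ _
      _ = ‖f y - g y‖ := by rw [sub_self, abs_zero, max_eq_left (abs_nonneg _), Real.norm_eq_abs]
  have hdi : Integrable (fun y => |f y - ψ y|) (σ + η) :=
    ((hf.integrable_of_mem_Icc hN).sub (hψm.integrable_of_mem_Icc hψN)).abs
  have he : ∫ y, |f y - ψ y| ∂(σ + η) ≤ ε / D :=
    (integral_mono hdi (((hf.integrable_of_mem_Icc hN).sub hgi).norm) hclose).trans hg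
  rw [integral_add_measure hdi.left_of_add_measure hdi.right_of_add_measure] at he
  have hσ0 : 0 ≤ ∫ y, |f y - ψ y| ∂σ := integral_nonneg fun _ => abs_nonneg _
  have hη0 : 0 ≤ ∫ y, |f y - ψ y| ∂η := integral_nonneg fun _ => abs_nonneg _
  have h1 : ∫ y, f y ∂σ ≤ ∫ y, ψ y ∂σ + ∫ y, |f y - ψ y| ∂σ := by
    rw [← integral_add (hψm.integrable_of_mem_Icc hψN) hdi.left_of_add_measure]
    refine integral_mono (hf.integrable_of_mem_Icc hN)
      ((hψm.integrable_of_mem_Icc hψN).add hdi.left_of_add_measure) fun y => ?_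
    have := le_abs_self (f y - ψ y)
    simp only
    linarith
  have h2 : ∫ y, ψ y ^ q ∂η ≤
      ∫ y, f y ^ q ∂η + q * N ^ (q - 1) * ∫ y, |f y - ψ y| ∂η := by
    rw [← integral_const_mul, ← integral_add ((hf.pow_const q).integrable_of_mem_Icc hfpow)
      (hdi.right_of_add_measure.const_mul _)]
    refine integral_mono ((hψm.pow_const q).integrable_of_mem_Icc hψpow)
      (((hf.pow_const q).integrable_of_mem_Icc hfpow).add
        (hdi.right_of_add_measure.const_mul _)) fun y => ?_
    have h3 := (le_abs_self _).trans (abs_pow_sub_pow_le (ψ y) (f y) q)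
    have h4 : max |ψ y| |f y| ^ (q - 1) ≤ N ^ (q - 1) := by
      refine pow_le_pow_left₀ (le_max_of_le_left (abs_nonneg _)) (max_le ?_ ?_) _
      · rw [abs_of_nonneg (hψN y).1]; exact (hψN y).2
      · rw [abs_of_nonneg (hN y).1]; exact (hN y).2
    have h5 : |ψ y - f y| * q * max |ψ y| |f y| ^ (q - 1) ≤
        q * N ^ (q - 1) * |f y - ψ y| := by
      rw [abs_sub_comm (ψ y)]
      calc |f y - ψ y| * q * max |ψ y| |f y| ^ (q - 1) ≤ |f y - ψ y| * q * N ^ (q - 1) := by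
            gcongr
        _ = _ := by ring
    simp only
    linarith
  have h3 := h ψ fun y => (hψN y).1
  have hsum : D * (∫ y, |f y - ψ y| ∂σ + ∫ y, |f y - ψ y| ∂η) ≤ ε := by
    rw [mul_comm]
    exact (le_div_iff₀ hDpos).1 he
  have hqN : 0 ≤ q * N ^ (q - 1) := by positivity
  have h4 : ∫ y, |f y - ψ y| ∂σ + q * N ^ (q - 1) * ∫ y, |f y - ψ y| ∂η ≤ ε := by
    rw [hD] at hsum
    nlinarith [mul_nonneg hqN hσ0, mul_nonneg hqN hη0]
  have h5 := mul_nonneg hqN hη0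
  linarith

end Duality

/-! ### Means from weak-type bounds -/

section LayerCake

variable {Y : Type*} [MeasurableSpace Y]

/-- A weak-type bound with exponent two controls the mean. -/
theorem integral_le_of_forall_sq_mul_measure_le {σ : Measure Y} [IsProbabilityMeasure σ] {f : Y → ℝ}
    (hf : Integrable f σ) (hf0 : 0 ≤ f) {a s : ℝ} (ha : 0 ≤ a) (hs : 0 < s)
    (h : ∀ t : ℝ, 0 < t → t ^ 2 * σ.real {y | t < f y} ≤ a) : ∫ y, f y ∂σ ≤ s + a / s := by
  have hpt : ∀ t : ℝ, 0 < t → σ {y | t < f y} ≤ ENNReal.ofReal (a * t ^ (-2 : ℝ)) := by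
    intro t ht
    rw [← ofReal_measureReal]
    refine ENNReal.ofReal_le_ofReal ?_
    rw [Real.rpow_neg ht.le, ← div_eq_mul_inv, le_div_iff₀ (by positivity), mul_comm]
    exact_mod_cast h t ht
  have hint : IntegrableOn (fun t : ℝ => a * t ^ (-2 : ℝ)) (Ioi s) :=
    (integrableOn_Ioi_rpow_of_lt (by norm_num) hs).const_mul a
  have htail : ∫⁻ t in Ioi s, ENNReal.ofReal (a * t ^ (-2 : ℝ)) = ENNReal.ofReal (a / s) := by
    rw [← ofReal_integral_eq_lintegral_ofReal hint, integral_const_mul,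
      integral_Ioi_rpow_of_lt (by norm_num) hs]
    · congr 1
      norm_num [Real.rpow_neg_one]
      rfl
    · filter_upwards [ae_restrict_mem measurableSet_Ioi] with t ht
      have : 0 < t := hs.trans ht
      positivity
  have hmain : ENNReal.ofReal (∫ y, f y ∂σ) ≤ ENNReal.ofReal (s + a / s) := by
    rw [ofReal_integral_eq_lintegral_ofReal hf (Eventually.of_forall hf0),
      lintegral_eq_lintegral_meas_lt σ (Eventually.of_forall hf0) hf.aemeasurable,
      ← Ioc_union_Ioi_eq_Ioi hs.le, ENNReal.ofReal_add hs.le (by positivity)]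
    -- Levels below `s` use total mass one; levels above `s` use the tail a/t², whose integral is
    -- a/s.
    refine (lintegral_union_le _ _ _).trans (add_le_add ?_ ?_)
    · calc ∫⁻ t in Ioc 0 s, σ {y | t < f y} ≤ ∫⁻ _t in Ioc 0 s, 1 :=
            lintegral_mono fun t => prob_le_one
        _ = ENNReal.ofReal s := by simp
    · rw [← htail]
      exact setLIntegral_mono_ae' measurableSet_Ioi
        (Eventually.of_forall fun t ht => hpt t (hs.trans ht))
  exact (ENNReal.ofReal_le_ofReal_iff (by positivity)).1 hmain

end LayerCake

/-! ### Construction of the representing probability measure -/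

section Representation

variable {Y : Type*} [MetricSpace Y] [MeasurableSpace Y] [BorelSpace Y]

theorem lintegral_averagedMeasure_map {𝒦 : Type*} [MeasurableSpace 𝒦] {r : ℝ}
    {j : 𝒦 → FrostmanFamily Y r} (hj : Measurable j) (P : Measure 𝒦) {f : Y → ℝ≥0∞}
    (hf : Measurable f) :
    ∫⁻ y, f y ∂(averagedMeasure (P.map j)) =
      (ENNReal.ofReal r)⁻¹ * ∫⁻ k, ∫⁻ y, f y ∂(j k).toMeasure ∂P := by
  rw [lintegral_averagedMeasure _ hf, lintegral_map _ hj]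
  exact (Measure.measurable_lintegral hf).comp (FrostmanFamily.measurable_toMeasure r)

variable [CompactSpace Y]

/-- If every ν ∈ K failed, then r⁻¹ ∫ φ^q dν < 2I for all of them, with I = ∫ φ dσ and q = 2(n+1).
For ε = σ{φ > t}, a ν charging {φ > t} and Chebyshev give c t^q ε^n < 2I, so (t²ε)^(n+1) < 2I/c
because ε ≤ 1. This weak L² bound forces I ≤ 2 or I ≤ 8/c, contrary to I > 2 + 8/c; hence the
exponent and the constant. -/
theorem exists_mem_integral_le {σ : Measure Y} [IsProbabilityMeasure σ] {K : Set (FiniteMeasure Y)}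
    {c r : ℝ} (hc : 0 < c) (hr : 0 < r) {n : ℕ}
    (hK : ∀ U : Set Y, IsOpen U → ∀ ε : ℝ, 0 < ε → ε ≤ 1 → ENNReal.ofReal ε ≤ σ U →
      ∃ ν ∈ K, ENNReal.ofReal (c * ε ^ n * r) ≤ (ν : Measure Y) U) (φ : C(Y, ℝ)) (hφ : 0 ≤ φ) :
    ∃ ν ∈ K, ∫ y, φ y ∂σ ≤
      2 + 8 / c + 1 / 2 * (r⁻¹ * ∫ y, φ y ^ (2 * (n + 1)) ∂(ν : Measure Y)) := by
  by_contra! hcon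
  set I := ∫ y, φ y ∂σ with hI
  have hφint : ∀ (ν : Measure Y) [IsFiniteMeasure ν] (q : ℕ), Integrable (fun y => φ y ^ q) ν :=
    fun ν _ q => (BoundedContinuousFunction.mkOfCompact (φ ^ q)).integrable ν
  have hφ0 : ∀ y, 0 ≤ φ y := fun y => hφ y
  have hbig : 2 + 8 / c < I := by
    obtain ⟨ν, hν, _⟩ := hK univ isOpen_univ 1 one_pos le_rfl (by simp)
    have h1 := hcon ν hν
    have h2 : 0 ≤ ∫ y, φ y ^ (2 * (n + 1)) ∂(ν : Measure Y) :=
      integral_nonneg fun y => pow_nonneg (hφ0 y) _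
    have h3 : 0 ≤ 1 / 2 * (r⁻¹ * ∫ y, φ y ^ (2 * (n + 1)) ∂(ν : Measure Y)) := by positivity
    linarith
  have hc8 : 0 < 8 / c := by positivity
  have hIpos : 0 < I := by linarith
  have hsmall : ∀ ν ∈ K, ∫ y, φ y ^ (2 * (n + 1)) ∂(ν : Measure Y) < 2 * I * r := by
    intro ν hν
    have h1 := hcon ν hν
    have h2 : r⁻¹ * ∫ y, φ y ^ (2 * (n + 1)) ∂(ν : Measure Y) < 2 * I := by linarith
    rw [inv_mul_eq_div] at h2
    exact (div_lt_iff₀ hr).1 h2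
  set a := max 1 (2 * I / c) with ha
  have ha1 : 1 ≤ a := le_max_left _ _
  have hweak : ∀ t : ℝ, 0 < t → t ^ 2 * σ.real {y | t < φ y} ≤ a := by
    intro t ht
    set ε := σ.real {y | t < φ y} with hε
    by_contra! hlt
    have hεpos : 0 < ε := by
      by_contra! h0
      have : t ^ 2 * ε ≤ 0 := mul_nonpos_of_nonneg_of_nonpos (by positivity) h0
      linarith
    have hε1 : ε ≤ 1 := measureReal_le_one
    obtain ⟨ν, hν, hm⟩ := hK {y | t < φ y} (isOpen_lt continuous_const φ.continuous) ε hεpos hε1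
      (by rw [hε, ofReal_measureReal])
    rw [ENNReal.ofReal_le_iff_le_toReal (measure_ne_top _ _)] at hm
    have h1 : t ^ (2 * (n + 1)) * (ν : Measure Y).real {y | t < φ y} < 2 * I * r := by
      refine lt_of_le_of_lt ?_ (hsmall ν hν)
      refine le_trans ?_ (mul_meas_ge_le_integral_of_nonneg
        (Eventually.of_forall fun y => pow_nonneg (hφ0 y) _) (hφint _ _) (t ^ (2 * (n + 1))))
      refine mul_le_mul_of_nonneg_left (measureReal_mono fun y hy => ?_) (by positivity)
      exact pow_le_pow_left₀ ht.le (le_of_lt hy) _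
    have h2 : (t ^ 2 * ε) ^ (n + 1) * c * r < 2 * I * r := by
      refine lt_of_le_of_lt ?_ h1
      calc (t ^ 2 * ε) ^ (n + 1) * c * r = t ^ (2 * (n + 1)) * (c * ε ^ (n + 1) * r) := by
            rw [mul_pow, ← pow_mul]; ring
        _ ≤ t ^ (2 * (n + 1)) * (c * ε ^ n * r) := by
            have : ε ^ (n + 1) ≤ ε ^ n := pow_le_pow_of_le_one hεpos.le hε1 (Nat.le_succ n)
            gcongr
        _ ≤ _ := mul_le_mul_of_nonneg_left hm (by positivity)
    have h3 : (t ^ 2 * ε) ^ (n + 1) < 2 * I / c := by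
      rw [lt_div_iff₀ hc]
      exact lt_of_mul_lt_mul_right h2 hr.le
    -- The maximum with 1 in `a` serves here: the root of order n+1 may be dropped only above 1.
    have h4 : t ^ 2 * ε ≤ (t ^ 2 * ε) ^ (n + 1) :=
      le_self_pow₀ (ha1.trans hlt.le) (Nat.succ_ne_zero n)
    have h5 : 2 * I / c ≤ a := le_max_right _ _
    linarith
  -- The level I/2 absorbs half of the mean and leaves I² ≤ 4a.
  have hfin := integral_le_of_forall_sq_mul_measure_le (s := I / 2)
    ((hφint σ 1).congr (by simp)) (fun y => hφ0 y) (by linarith) (by positivity)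
    hweak
  rw [← hI] at hfin
  have h6 : I ^ 2 ≤ 4 * a := by
    have h7 : I / 2 ≤ a / (I / 2) := by linarith
    rw [le_div_iff₀ (by positivity)] at h7
    nlinarith
  rcases le_total (2 * I / c) 1 with h8 | h8
  · rw [ha, max_eq_left h8] at h6
    nlinarith
  · rw [ha, max_eq_right h8] at h6
    have h9 : 4 * (2 * I / c) = 8 / c * I := by ring
    rw [h9] at h6
    nlinarith

/-- A probability measure whose superlevel sets carry polynomially much Frostman mass has a
rectifiable representation with quantitative bounds. -/
theorem exists_rectifiableRepresentation {σ : Measure Y} [IsProbabilityMeasure σ]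
    {c r : ℝ} (hc : 0 < c) (hr : 0 < r) {n : ℕ}
    (hK : ∀ U : Set Y, IsOpen U → ∀ ε : ℝ, 0 < ε → ε ≤ 1 → ENNReal.ofReal ε ≤ σ U →
      ∃ ν ∈ boxFrostmanFamily Y (r / 4), ENNReal.ofReal (c * ε ^ n * r) ≤ (ν : Measure Y) U) :
    ∃ P : Measure (FrostmanFamily Y r), IsProbabilityMeasure P ∧ σ ≪ averagedMeasure P ∧
      ∫⁻ y, σ.rnDeriv (averagedMeasure P) y ^
        (((2 * (n + 1) : ℕ) : ℝ) / ((2 * (n + 1) : ℕ) - 1)) ∂(averagedMeasure P) ≤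
          ENNReal.ofReal (2 * (2 + 8 / c)) := by
  set q := 2 * (n + 1) with hq
  set B := 2 + 8 / c with hB
  set K := boxFrostmanFamily Y (r / 4) with hKdef
  have hcomp : CompactSpace K := isCompact_iff_compactSpace.1 (isCompact_boxFrostmanFamily (r / 4))
  obtain ⟨ν₀, hν₀, _⟩ := hK univ isOpen_univ 1 one_pos le_rfl (by simp)
  have hne : Nonempty K := ⟨⟨ν₀, hν₀⟩⟩
  let _ : MeasurableSpace K := borel K
  have _ : BorelSpace K := ⟨rfl⟩
  have hintcont : ∀ φ : C(Y, ℝ), Continuous fun ν : K =>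
      ∫ y, φ y ∂((ν : FiniteMeasure Y) : Measure Y) :=
    fun φ => (FiniteMeasure.continuous_integral_continuousMap φ).comp continuous_subtype_val
  have hint : ∀ (φ : C(Y, ℝ)) (ν : Measure Y) [IsFiniteMeasure ν], Integrable (fun y => φ y) ν :=
    fun φ ν _ => (BoundedContinuousFunction.mkOfCompact φ).integrable ν
  -- A nonnegative mean of `G φ` under P is the desired inequality for φ.
  let G : {φ : C(Y, ℝ) // 0 ≤ φ} → C(K, ℝ) := fun φ =>
    ⟨fun ν => B + 1 / 2 * (r⁻¹ * ∫ y, (φ.1 ^ q) y ∂((ν : FiniteMeasure Y) : Measure Y)) -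
      ∫ y, φ.1 y ∂σ, by
      have := hintcont (φ.1 ^ q)
      fun_prop⟩
  obtain ⟨P, hP⟩ := exists_probabilityMeasure_forall_integral_nonneg G (by
    intro t w hw hw1
    obtain ⟨ν, hν, hle⟩ := exists_mem_integral_le hc hr hK (∑ i ∈ t, w i • i.1)
      (Finset.sum_nonneg fun i hi => smul_nonneg (hw i hi) i.2)
    refine ⟨⟨ν, hν⟩, ?_⟩
    have h1 : ∫ y, (∑ i ∈ t, w i • i.1 : C(Y, ℝ)) y ∂σ = ∑ i ∈ t, w i * ∫ y, i.1 y ∂σ := by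
      simp only [ContinuousMap.coe_sum, Finset.sum_apply, ContinuousMap.coe_smul, Pi.smul_apply,
        smul_eq_mul]
      rw [integral_finsetSum _ fun i _ => (hint i.1 σ).const_mul _]
      exact Finset.sum_congr rfl fun i _ => integral_const_mul _ _
    -- Convexity of the q-th power reduces a convex combination of the functions `G φ` to the single
    -- function Σ wᵢφᵢ.
    have h2 : ∫ y, (∑ i ∈ t, w i • i.1 : C(Y, ℝ)) y ^ q ∂(ν : Measure Y) ≤
        ∑ i ∈ t, w i * ∫ y, (i.1 ^ q) y ∂(ν : Measure Y) := by
      have h3 : ∑ i ∈ t, w i * ∫ y, (i.1 ^ q) y ∂(ν : Measure Y) =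
          ∫ y, ∑ i ∈ t, w i * (i.1 ^ q) y ∂(ν : Measure Y) := by
        rw [integral_finsetSum _ fun i _ => (hint (i.1 ^ q) _).const_mul _]
        exact Finset.sum_congr rfl fun i _ => (integral_const_mul _ _).symm
      rw [h3]
      refine integral_mono (hint ((∑ i ∈ t, w i • i.1) ^ q) _)
        (integrable_finsetSum _ fun i _ => (hint (i.1 ^ q) _).const_mul _) fun y => ?_
      simp only [ContinuousMap.coe_sum, Finset.sum_apply, ContinuousMap.coe_smul, Pi.smul_apply,
        smul_eq_mul, ContinuousMap.pow_apply]
      exact Real.pow_arith_mean_le_arith_mean_pow t w (fun i => i.1 y) hw hw1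
        (fun i _ => i.2 y) q
    have h4 : ∑ i ∈ t, w i * G i ⟨ν, hν⟩ =
        B + 1 / 2 * (r⁻¹ * ∑ i ∈ t, w i * ∫ y, (i.1 ^ q) y ∂(ν : Measure Y)) -
          ∑ i ∈ t, w i * ∫ y, i.1 y ∂σ := by
      simp only [G, ContinuousMap.coe_mk, mul_sub, mul_add, Finset.sum_sub_distrib,
        Finset.sum_add_distrib, ← Finset.sum_mul, hw1, one_mul, Finset.mul_sum]
      congr 2
      exact Finset.sum_congr rfl fun i _ => by ring
    rw [h4, ← h1]
    have h5 := mul_le_mul_of_nonneg_left h2 (inv_nonneg.2 hr.le)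
    linarith)
  -- The packing bound r/4 gives back length at most r.
  let j : K → FrostmanFamily Y r := fun ν => ⟨ν.1, ν.2.1, by
    obtain ⟨γ, hconn, hbox, h0⟩ := ν.2.2
    refine ⟨γ, ⟨γ.isCompact, γ.nonempty, hconn⟩, ?_, h0⟩
    have := hbox.hausdorffMeasure_le (by positivity)
    rwa [mul_div_cancel₀ r (by norm_num)] at this⟩
  have hj : Continuous j := Continuous.subtype_mk continuous_subtype_val _
  have hjm : Measurable j := hj.measurable
  have hjP : IsProbabilityMeasure ((P : Measure K).map j) :=
    Measure.isProbabilityMeasure_map hjm.aemeasurable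
  set η := averagedMeasure ((P : Measure K).map j) with hη
  have hηfin : IsFiniteMeasure η := ⟨by
    have h1 := lintegral_averagedMeasure_map hjm (P : Measure K) (f := fun _ => 1) measurable_const
    simp only [lintegral_const, one_mul] at h1
    rw [hη, h1]
    refine ENNReal.mul_lt_top (by simpa using hr) ?_
    calc ∫⁻ k, (j k).toMeasure univ ∂(P : Measure K)
        ≤ ∫⁻ _k, ENNReal.ofReal (diam (univ : Set Y) + 1) ∂(P : Measure K) :=
          lintegral_mono fun k => (j k).2.1.measure_univ_le
      _ < ∞ := by simp⟩
  have havg : ∀ ψ : C(Y, ℝ), 0 ≤ ψ → ∫ y, ψ y ∂η =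
      r⁻¹ * ∫ ν : K, ∫ y, ψ y ∂((ν : FiniteMeasure Y) : Measure Y) ∂(P : Measure K) := by
    intro ψ hψ
    have hψ0 : ∀ y, 0 ≤ ψ y := fun y => hψ y
    have hin0 : ∀ ν : K, 0 ≤ ∫ y, ψ y ∂((ν : FiniteMeasure Y) : Measure Y) :=
      fun ν => integral_nonneg hψ0
    have hψK : Integrable (fun ν : K => ∫ y, ψ y ∂((ν : FiniteMeasure Y) : Measure Y))
        (P : Measure K) :=
      (BoundedContinuousFunction.mkOfCompact ⟨_, hintcont ψ⟩).integrable _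
    have h1 : ENNReal.ofReal (∫ y, ψ y ∂η) = ENNReal.ofReal
        (r⁻¹ * ∫ ν : K, ∫ y, ψ y ∂((ν : FiniteMeasure Y) : Measure Y) ∂(P : Measure K)) := by
      rw [ofReal_integral_eq_lintegral_ofReal (hint ψ η) (Eventually.of_forall hψ0), hη,
        lintegral_averagedMeasure_map hjm _ ψ.continuous.measurable.ennreal_ofReal,
        ENNReal.ofReal_mul (by positivity), ENNReal.ofReal_inv_of_pos hr,
        ofReal_integral_eq_lintegral_ofReal hψK (Eventually.of_forall hin0)]
      congr 1
      refine lintegral_congr fun ν => ?_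
      exact (ofReal_integral_eq_lintegral_ofReal (hint ψ _) (Eventually.of_forall hψ0)).symm
    exact (ENNReal.ofReal_eq_ofReal_iff (integral_nonneg hψ0)
      (mul_nonneg (by positivity) (integral_nonneg hin0))).1 h1
  have hcont : ∀ φ : C(Y, ℝ), 0 ≤ φ → ∫ y, φ y ∂σ ≤ B + 1 / 2 * ∫ y, φ y ^ q ∂η := by
    intro φ hφ
    have h1 := hP ⟨φ, hφ⟩
    have h2 := havg (φ ^ q) (fun y => pow_nonneg (hφ y) q)
    have hKint : Integrable (fun ν : K => ∫ y, (φ ^ q) y ∂((ν : FiniteMeasure Y) : Measure Y))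
        (P : Measure K) :=
      (BoundedContinuousFunction.mkOfCompact ⟨_, hintcont (φ ^ q)⟩).integrable _
    have h3 : ∫ ν, G ⟨φ, hφ⟩ ν ∂(P : Measure K) =
        B + 1 / 2 * (r⁻¹ * ∫ ν : K, ∫ y, (φ ^ q) y ∂((ν : FiniteMeasure Y) : Measure Y)
          ∂(P : Measure K)) - ∫ y, φ y ∂σ := by
      simp only [G, ContinuousMap.coe_mk]
      have hsum : Integrable (fun ν : K => B + 1 / 2 * (r⁻¹ *
          ∫ y, (φ ^ q) y ∂((ν : FiniteMeasure Y) : Measure Y))) (P : Measure K) :=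
        (integrable_const _).add ((hKint.const_mul _).const_mul _)
      rw [integral_sub hsum (integrable_const _),
        integral_add (integrable_const _) ((hKint.const_mul _).const_mul _),
        integral_const_mul, integral_const_mul]
      simp
    rw [h3, ← h2] at h1
    simp only [ContinuousMap.pow_apply] at h1
    linarith
  have hbdd := fun (f : Y → ℝ) (hf : Measurable f) (N : ℝ) (hN : ∀ y, f y ∈ Icc 0 N) =>
    integral_le_of_forall_continuous hcont hf hN
  exact ⟨(P : Measure K).map j, hjP, absolutelyContinuous_of_integral_le (by omega) hbdd,
    lintegral_rnDeriv_rpow_le (by omega) hbdd⟩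

end Representation

/-! ### The main theorem -/

section Main

variable {X : Type*} [MetricSpace X] [MeasurableSpace X] [BorelSpace X]

theorem comap_normalizedRestriction_apply (μ : Measure X) (x : X) {r : ℝ} {S : Set X}
    (hr : 0 < r) (hS : MeasurableSet S) :
    (normalizedRestriction μ x r).comap ((↑) : closure (ball x (2 * r)) → X) ((↑) ⁻¹' S) =
      (μ (ball x r))⁻¹ * μ (S ∩ ball x r) := by
  have hT : MeasurableSet (closure (ball x (2 * r))) := isClosed_closure.measurableSet
  have hsub : ball x r ⊆ closure (ball x (2 * r)) :=
    (ball_subset_ball (by linarith)).trans subset_closure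
  rw [(MeasurableEmbedding.subtype_coe hT).comap_apply, Subtype.image_preimage_coe,
    normalizedRestriction, Measure.smul_apply, smul_eq_mul, Measure.restrict_apply (hT.inter hS),
    inter_right_comm, inter_eq_right.2 hsub, inter_comm]

end Main

theorem mainTheorem1 {X : Type*} [MetricSpace X] [CompleteSpace X]
    [MeasurableSpace X] [BorelSpace X] (μ : Measure X)
    (hdoubling : IsDoublingMeasure μ) (hquasi : IsQuasiconvexSpace X)
    (hA : IsAInftyOnCurves μ) :
    ∃ p A : ℝ, 1 < p ∧ 1 ≤ A ∧
      ∀ (x : X) (r : ℝ), 0 < r → ENNReal.ofReal r ≤ Metric.ediam (Set.univ : Set X) →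
        IsCompact (closure (Metric.ball x (2 * r))) ∧
        HasRectifiableRepresentation
          ((normalizedRestriction μ x r).comap
            ((↑) : closure (Metric.ball x (2 * r)) → X)) r (ENNReal.ofReal p) ∧
        representationNorm
          ((normalizedRestriction μ x r).comap
            ((↑) : closure (Metric.ball x (2 * r)) → X)) r (ENNReal.ofReal p)
          ≤ ENNReal.ofReal A := by
  have hproper := hdoubling.properSpace
  obtain ⟨c, n, hc, hcarry⟩ := hA.exists_carriesFrostmanMeasure hdoubling hquasi
  obtain ⟨C, hC⟩ := hdoubling
  set q : ℕ := 2 * (n + 1) with hq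
  have hq1 : (0 : ℝ) < (q : ℝ) - 1 := by
    have : 2 ≤ q := by omega
    have : (2 : ℝ) ≤ q := by exact_mod_cast this
    linarith
  set p : ℝ := (q : ℝ) / ((q : ℝ) - 1) with hp
  have hp1 : 1 < p := by
    rw [hp, one_lt_div hq1]
    linarith
  set A : ℝ := 2 * (2 + 8 / c) with hAdef
  have hA1 : 1 ≤ A := by
    have : 0 < 8 / c := by positivity
    linarith
  refine ⟨p, A, hp1, hA1, fun x r hr hrX => ?_⟩
  have hcomp : IsCompact (closure (ball x (2 * r))) := isBounded_ball.isCompact_closure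
  refine ⟨hcomp, ?_⟩
  have hspace : CompactSpace (closure (ball x (2 * r))) := isCompact_iff_compactSpace.1 hcomp
  set σ : Measure (closure (ball x (2 * r))) := (normalizedRestriction μ x r).comap (↑) with hσ
  have hμ0 := (hC x r hr).1.ne'
  have hμt := (hC x r hr).2.1.ne
  have hσprob : IsProbabilityMeasure σ := ⟨by
    have := comap_normalizedRestriction_apply μ x hr MeasurableSet.univ
    rwa [preimage_univ, univ_inter, ENNReal.inv_mul_cancel hμ0 hμt] at this⟩
  obtain ⟨P, hP, hac, hint⟩ := exists_rectifiableRepresentation (σ := σ) hc hr (n := n) (by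
    rintro _ ⟨V, hV, rfl⟩ ε hε hε1 hεV
    rw [hσ, comap_normalizedRestriction_apply μ x hr hV.measurableSet, mul_comm,
      ← div_eq_mul_inv, ENNReal.le_div_iff_mul_le (Or.inl hμ0) (Or.inl hμt)] at hεV
    obtain ⟨ν, hν, hm⟩ := (hcarry x r hr hrX (V ∩ ball x r) (hV.inter isOpen_ball)
      inter_subset_right ε hε hε1 hεV).exists_mem_boxFrostmanFamily hr (by positivity) hcomp
      inter_subset_right
    exact ⟨ν, hν, hm.trans (measure_mono (preimage_mono inter_subset_left))⟩)
  have hnorm : eLpNorm (σ.rnDeriv (averagedMeasure P)) (ENNReal.ofReal p) (averagedMeasure P) ≤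
      ENNReal.ofReal A := by
    have hp0 : 0 < p := by linarith
    rw [eLpNorm_eq_lintegral_rpow_enorm_toReal (by simpa using hp0) ENNReal.ofReal_ne_top,
      ENNReal.toReal_ofReal hp0.le]
    simp only [enorm_eq_self]
    -- The p-th moment is at most `A`; since A ≥ 1 and 1/p ≤ 1, so is its root.
    calc (∫⁻ y, σ.rnDeriv (averagedMeasure P) y ^ p ∂(averagedMeasure P)) ^ (1 / p)
        ≤ ENNReal.ofReal A ^ (1 / p) := ENNReal.rpow_le_rpow hint (by positivity)
      _ ≤ ENNReal.ofReal A ^ (1 : ℝ) := ENNReal.rpow_le_rpow_of_exponent_le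
          (by simpa using hA1) ((div_le_one hp0).2 hp1.le)
      _ = ENNReal.ofReal A := ENNReal.rpow_one _
  refine ⟨⟨P, hP, hac, (Measure.measurable_rnDeriv _ _).aestronglyMeasurable,
    hnorm.trans_lt ENNReal.ofReal_lt_top⟩, ?_⟩
  exact (iInf_le_of_le P (iInf_le_of_le hP (iInf_le _ hac))).trans hnorm

end
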